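/- Let $\Delta=\{\alpha_1,\dots,\alpha_n\}$ be the simple roots of an irreducible reduced crystallographic root system spanning the Euclidean space $\mathbb{R}^n$ (that is, of a compact simple Lie group $G$ of rank $n$). For a root $\alpha$ put $\alpha^\vee=2\alpha/\langle\alpha,\alpha\rangle$, let $\xi$ be the highest root and $\eta$ the highest root of the dual root system, whose simple roots are $\Delta^\vee=\{\alpha_1^\vee,\dots,\alpha_n^\vee\}$. Let $Q=\sum_i\mathbb{Z}\alpha_i$, $Q^\vee=\sum_i\mathbb{Z}\alpha_i^\vee$, $P^\vee=\{\omega\in\mathbb{R}^n:\langle\omega,\alpha_i\rangle\in\mathbb{Z}\ \forall i\}$, $P=\{\omega\in\mathbb{R}^n:\langle\omega,\alpha_i^\vee\rangle\in\mathbb{Z}\ \forall i\}$, and let $c=\det\bigl(2\langle\alpha_i,\alpha_k\rangle/\langle\alpha_k,\alpha_k\rangle\bigr)_{i,k}$ be the determinant of the Cartan matrix. Let $W$ be the Weyl group, generated by the reflections $r_i$ in the simple roots, and $W^e=\{w\in W:\det w=1\}$. Put $$F=\{a:\langle a,\alpha_i\rangle\ge 0\ \forall i,\ \langle a,\xi\rangle\le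 1\},\qquad F^\vee=\{a:\langle a,\alpha_i^\vee\rangle\ge 0\ \forall i,\ \langle a,\eta\rangle\le 1\},$$ and, for fixed $j,j'\in\{1,\dots,n\}$, $F^e=F\cup r_j\,\mathrm{int}(F)$ and $F^{e\vee}=F^\vee\cup r_{j'}\,\mathrm{int}(F^\vee)$. For an integer $M\ge 1$ let $$F^e_M=\tfrac1M P^\vee\cap F^e,\qquad \Lambda^e_M=P\cap M F^{e\vee}$$ (each point standing for its coset modulo $Q^\vee$, respectively $MQ$). For $b\in P$ and $a\in\mathbb{R}^n$ let $\Xi_b(a)=\sum_{w\in W^e}e^{2\pi i\langle wb,a\rangle}$. For $x\in F^e_M$ let $\varepsilon^e(x)$ be the number of elements of the $W^e$-orbit of $x+Q^\vee$ in $\mathbb{R}^n/Q^\vee$; for $\lambda\in\Lambda^e_M$ let $h^{e\vee}_\lambda$ be the order of the stabilizer of $\lambda+MQ$ in $W^e$. For $f,g:F^e_M\to\mathbb{C}$ let $\langle f,g\rangle_{F^e_M}=\sum_{x\in F^e_M}\varepsilon^e(x)f(x)\overline{g(x)}$. Then $F^e_M$ and $\Lambda^e_M$ are finite, and for every $f:F^e_M\to\mathbb{C}$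 there is exactly one family of complex coefficients $(c_\lambda)_{\lambda\in\Lambda^e_M}$ such that the function $\Xi^M=\sum_{\lambda\in\Lambda^e_M}c_\lambda\,\Xi_\lambda$ on $\mathbb{R}^n$ satisfies $\Xi^M(x)=f(x)$ for all $x\in F^e_M$. These coefficients are given, for every $\lambda\in\Lambda^e_M$, by $$c_\lambda=\frac{\langle f,\Xi_\lambda\rangle_{F^e_M}}{\langle\Xi_\lambda,\Xi_\lambda\rangle_{F^e_M}}=\bigl(c\,|W^e|\,M^n\,h^{e\vee}_\lambda\bigr)^{-1}\sum_{x\in F^e_M}\varepsilon^e(x)\,f(x)\,\overline{\Xi_\lambda(x)},$$ where $\langle\Xi_\lambda,\Xi_\lambda\rangle_{F^e_M}\ne 0$, and the Plancherel formula $$\sum_{x\in F^e_M}\varepsilon^e(x)\,|f(x)|^2=c\,|W^e|\,M^n\sum_{\lambda\in\Lambda^e_M}h^{e\vee}_\lambda\,|c_\lambda|^2$$ holds. -/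

import Mathlib

open scoped RealInnerProductSpace

noncomputable section

namespace ETransform

variable {V : Type*} [NormedAddCommGroup V] [InnerProductSpace ℝ V] {ι : Type*}

/-- The root pairing `P` is a root system in the Euclidean space `V` in the classical sense:
roots and coroots both live in `V`, they are paired by the inner product, and
`α^∨ = 2 α / ⟪α, α⟫`. -/
structure IsEuclidean (P : RootPairing ι ℝ V V) : Prop where
  toLinearMap_apply : ∀ x y : V, P.toLinearMap x y = ⟪x, y⟫
  coroot_eq : ∀ i, P.coroot i = (2 / ⟪P.root i, P.root i⟫) • P.root i

variable {P : RootPairing ι ℝ V V} (b : P.Base)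

/-- `P.root ξ` is the highest root with respect to the simple roots `b`: its difference with any
root is a sum of simple roots.  Applied to `b.flip` it describes the highest dual root. -/
def IsHighestRoot (ξ : ι) : Prop :=
  ∀ i, P.root ξ - P.root i ∈ AddSubmonoid.closure (P.root '' b.support)

open Classical in
/-- The order `c` of the center: the determinant of the Cartan matrix
`C_{ij} = 2 ⟪α_i, α_j⟫ / ⟪α_j, α_j⟫`. -/
def centerOrder [P.IsCrystallographic] : ℤ := b.cartanMatrix.det

/-- The lattice spanned by the simple roots: `Q` for `b`, and `Q^∨` for `b.flip`. -/
def rootLattice : AddSubgroup V := AddSubgroup.closure (P.root '' b.support)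

/-- The set of vectors with integral inner product with every simple root: the dual weight
lattice `P^∨` for `b`, and the weight lattice `P` for `b.flip`. -/
def dualWeightLattice : Set V := {ω | ∀ i ∈ b.support, ∃ k : ℤ, ⟪ω, P.root i⟫ = k}

/-- The Weyl group `W`, generated by the reflections in the simple roots. -/
def weylGroup : Subgroup (V ≃ₗ[ℝ] V) := Subgroup.closure (P.reflection '' b.support)

/-- The even Weyl group `W^e`: the elements of `W` with determinant one. -/
def evenWeylGroup : Subgroup (V ≃ₗ[ℝ] V) where
  carrier := {w | w ∈ weylGroup b ∧ LinearEquiv.det w = 1}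
  mul_mem' := fun hx hy => ⟨mul_mem hx.1 hy.1, by rw [map_mul, hx.2, hy.2, one_mul]⟩
  one_mem' := ⟨one_mem _, map_one _⟩
  inv_mem' := fun hx => ⟨inv_mem hx.1, by rw [map_inv, hx.2, inv_one]⟩

theorem finite_weylGroup [Finite ι] [P.IsRootSystem] : Finite (weylGroup b) := by
  have key : ∀ w ∈ weylGroup b, ∀ i, w (P.root i) ∈ Set.range P.root := by
    intro w hw
    induction hw using Subgroup.closure_induction'' with
    | mem x hx =>
      obtain ⟨k, -, rfl⟩ := hx
      exact fun i => P.mapsTo_reflection_root k ⟨i, rfl⟩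
    | inv_mem x hx =>
      obtain ⟨k, -, rfl⟩ := hx
      rw [P.reflection_inv]
      exact fun i => P.mapsTo_reflection_root k ⟨i, rfl⟩
    | one => exact fun i => ⟨i, rfl⟩
    | mul x y _ _ hx hy =>
      intro i
      obtain ⟨k, hk⟩ := hy i
      rw [LinearEquiv.mul_apply, ← hk]
      exact hx k
  refine Finite.of_injective
    (fun w : weylGroup b => fun i => (⟨_, key w.1 w.2 i⟩ : Set.range P.root)) ?_
  intro w w' h
  refine Subtype.ext (LinearEquiv.toLinearMap_injective ?_)
  refine LinearMap.ext_on_range (v := P.root) RootPairing.IsRootSystem.span_root_eq_top ?_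
  exact fun i => congrArg Subtype.val (congrFun h i)

instance [Finite ι] [P.IsRootSystem] : Finite (evenWeylGroup b) :=
  haveI := finite_weylGroup b
  Finite.of_injective (fun w : evenWeylGroup b => (⟨w.1, w.2.1⟩ : weylGroup b))
    fun _ _ h => Subtype.ext (congrArg (fun u : weylGroup b => (u : V ≃ₗ[ℝ] V)) h)

instance [Finite ι] [P.IsRootSystem] : Fintype (evenWeylGroup b) := Fintype.ofFinite _

/-- The closed simplex `F`, cut out by the simple roots and the highest root
(`F^∨` for `b.flip`). -/
def simplex (ξ : ι) : Set V :=
  {a | (∀ i ∈ b.support, 0 ≤ ⟪a, P.root i⟫) ∧ ⟪a, P.root ξ⟫ ≤ 1}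

/-- The interior of the simplex `F`. -/
def openSimplex (ξ : ι) : Set V :=
  {a | (∀ i ∈ b.support, 0 < ⟪a, P.root i⟫) ∧ ⟪a, P.root ξ⟫ < 1}

/-- `F^e = F ∪ r_j int F` (and `F^{e∨}` for `b.flip`; the reflection attached to a root and the one
attached to its dual root coincide). -/
def evenDomain (ξ : ι) (j : b.support) : Set V :=
  simplex b ξ ∪ P.reflection j '' openSimplex b ξ

/-- The grid `F^e_M`: the points of `(1/M) P^∨` in `F^e`. -/
def pointGrid (ξ : ι) (j : b.support) (M : ℕ) : Set V :=
  {a | (M : ℝ) • a ∈ dualWeightLattice b ∧ a ∈ evenDomain b ξ j}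

/-- The grid `Λ^e_M`: the points of the weight lattice `P` in `M F^{e∨}`. -/
def weightGrid (η : ι) (j : b.flip.support) (M : ℕ) : Set V :=
  {l | l ∈ dualWeightLattice b.flip ∧ ∃ a ∈ evenDomain b.flip η j, l = (M : ℝ) • a}

/-- `ε^e(x)`: the number of elements of the orbit of `x + Q^∨` under `W^e` in the torus
`V / Q^∨`. -/
def orbitSize (x : V) : ℕ :=
  (Set.range fun w : evenWeylGroup b =>
    (QuotientAddGroup.mk ((w : V ≃ₗ[ℝ] V) x) : V ⧸ rootLattice b.flip)).ncard

/-- `h^{e∨}_λ`: the order of the stabilizer of `λ + M Q` in `W^e`. -/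
def stabOrder (M : ℕ) (l : V) : ℕ :=
  Nat.card {w : evenWeylGroup b // ∃ q ∈ rootLattice b, (w : V ≃ₗ[ℝ] V) l = l + (M : ℝ) • q}

/-- The `E`-function `Ξ_l(a) = ∑_{w ∈ W^e} exp(2πi ⟪w l, a⟫)`. -/
def eFun [Finite ι] [P.IsRootSystem] (l a : V) : ℂ :=
  ∑ w : evenWeylGroup b,
    Complex.exp (2 * Real.pi * Complex.I * ((⟪(w : V ≃ₗ[ℝ] V) l, a⟫ : ℝ) : ℂ))

/-- The scalar product `∑_{x ∈ F^e_M} ε^e(x) f(x) conj(g(x))` of functions on `F^e_M`. -/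
def gridInner (ξ : ι) (j : b.support) (M : ℕ) (f g : pointGrid b ξ j M → ℂ) : ℂ :=
  ∑ᶠ x : pointGrid b ξ j M, (orbitSize b (x : V) : ℂ) * f x * (starRingEnd ℂ) (g x)

/-- The interpolating function `Ξ^M(x) = ∑_{λ ∈ Λ^e_M} c_λ Ξ_λ(x)`, `x ∈ V`. -/
def interpolant [Finite ι] [P.IsRootSystem] (η : ι) (j : b.flip.support) (M : ℕ)
    (c : weightGrid b η j M → ℂ) (x : V) : ℂ :=
  ∑ᶠ l : weightGrid b η j M, c l * eFun b (l : V) x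

end ETransform

end

/-! This is Fourier analysis on the finite group A = (1/M)P^∨/Q^∨, made invariant under W^e. The
order of A is c·M^n (`card_torusGrid`), and its characters are x ↦ exp(2πi⟨λ,x⟩) with λ in P modulo
MQ (`exists_weight_of_addChar`, `exists_rootLattice_of_inner_int`). Summing a character over W^e
gives Ξ_λ.

The geometric input is that F^e meets every orbit of W^e ⋉ Q^∨ exactly once
(`exists_mem_evenDomain`, `eq_of_mem_evenDomain`). So F^e_M represents the W^e-orbits on A, with
sizes ε^e; for the dual root system, scaled by M, Λ^e_M represents the W^e-orbits on P/MQ. This is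
deduced from the alcove theorem for the full affine Weyl group: existence by minimizing the distance
to an interior point, uniqueness by the exchange condition. An odd element is made even by r_j at
interior points, and by the reflection in a wall through the point at boundary points.

The weighted sum over the grid is therefore a sum over A (`sum_torusGrid`), and orthogonality of
characters makes the Ξ_λ orthogonal with square norm c|W^e|M^n h_λ (`gridInner_eFun_of_ne`,
`gridInner_eFun_self`). This forces the coefficients and yields Plancherel. Existence needs no
comparison of |F^e_M| with |Λ^e_M|: f is extended invariantly to A, expanded in characters and
averaged over W^e (`exists_interpolant`). -/

noncomputable section

namespace ETransform

/-! ### Root systems, duality and the Weyl group in Euclidean terms -/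

section Euclidean

variable {V : Type*} [NormedAddCommGroup V] [InnerProductSpace ℝ V] {ι : Type*}
  {P : RootPairing ι ℝ V V} (hP : IsEuclidean P)

include hP

theorem IsEuclidean.inner_root_coroot (i j : ι) : ⟪P.root i, P.coroot j⟫ = P.pairing i j := by
  rw [← hP.toLinearMap_apply, P.root_coroot_eq_pairing]

theorem IsEuclidean.inner_coroot_root (i j : ι) : ⟪P.coroot i, P.root j⟫ = P.pairing j i := by
  rw [real_inner_comm, hP.inner_root_coroot]

omit hP in
theorem inner_root_self_pos (P : RootPairing ι ℝ V V) (i : ι) : 0 < ⟪P.root i, P.root i⟫ :=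
  real_inner_self_pos.2 (P.ne_zero i)

theorem IsEuclidean.reflection_apply (i : ι) (x : V) :
    P.reflection i x = x - ⟪x, P.coroot i⟫ • P.root i := by
  rw [P.reflection_apply, ← hP.toLinearMap_apply]; rfl

theorem IsEuclidean.reflection_apply' (i : ι) (x : V) :
    P.reflection i x = x - ⟪x, P.root i⟫ • P.coroot i := by
  rw [hP.reflection_apply, hP.coroot_eq, inner_smul_right, smul_smul, mul_comm]

theorem IsEuclidean.inner_reflection (i : ι) (x y : V) :
    ⟪P.reflection i x, y⟫ = ⟪x, P.reflection i y⟫ := by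
  rw [hP.reflection_apply, hP.reflection_apply', inner_sub_left, inner_sub_right,
    inner_smul_left, inner_smul_right, real_inner_comm y (P.root i)]
  simp [mul_comm]

theorem IsEuclidean.coreflection_eq (i : ι) : P.coreflection i = P.reflection i := by
  ext x
  rw [hP.reflection_apply', P.coreflection_apply, real_inner_comm, ← hP.toLinearMap_apply]

theorem IsEuclidean.flip : IsEuclidean P.flip where
  toLinearMap_apply x y := by
    rw [RootPairing.flip_toLinearMap, LinearMap.flip_apply, hP.toLinearMap_apply, real_inner_comm]
  coroot_eq i := by
    have h := (inner_root_self_pos P i).ne'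
    simp only [RootPairing.flip_coroot, RootPairing.flip_root, hP.coroot_eq, inner_smul_left,
      inner_smul_right, smul_smul]
    rw [eq_comm]
    convert! one_smul ℝ (P.root i)
    simp only [conj_trivial]
    field_simp

variable (b : P.Base)

theorem IsEuclidean.weylGroup_flip : weylGroup b.flip = weylGroup b := by
  unfold weylGroup
  congr 1
  refine Set.image_congr fun i _ => ?_
  rw [← hP.coreflection_eq]; rfl

theorem IsEuclidean.evenWeylGroup_flip : evenWeylGroup b.flip = evenWeylGroup b := by
  ext w
  change w ∈ weylGroup b.flip ∧ _ ↔ w ∈ weylGroup b ∧ _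
  rw [hP.weylGroup_flip b]

theorem IsEuclidean.inner_weylGroup {w : V ≃ₗ[ℝ] V} (hw : w ∈ weylGroup b) (x y : V) :
    ⟪w x, w y⟫ = ⟪x, y⟫ := by
  induction hw using Subgroup.closure_induction'' generalizing x y with
  | mem u hu =>
    obtain ⟨k, -, rfl⟩ := hu
    rw [hP.inner_reflection, P.reflection_same]
  | inv_mem u hu =>
    obtain ⟨k, -, rfl⟩ := hu
    rw [P.reflection_inv, hP.inner_reflection, P.reflection_same]
  | one => rfl
  | mul u v _ _ hu hv => rw [LinearEquiv.mul_apply, LinearEquiv.mul_apply, hu, hv]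

theorem IsEuclidean.inner_weylGroup_left {w : V ≃ₗ[ℝ] V} (hw : w ∈ weylGroup b) (x y : V) :
    ⟪w x, y⟫ = ⟪x, w⁻¹ y⟫ := by
  rw [← hP.inner_weylGroup b hw x (w⁻¹ y), ← LinearEquiv.mul_apply, mul_inv_cancel]; rfl

omit hP in
theorem root_mem_rootLattice (i : ι) : P.root i ∈ rootLattice b := by
  have h : AddSubmonoid.closure (P.root '' b.support) ≤ (rootLattice b).toAddSubmonoid :=
    AddSubmonoid.closure_le.2 AddSubgroup.subset_closure
  rcases b.root_mem_or_neg_mem i with hi | hi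
  · exact h hi
  · exact neg_mem_iff.1 (h hi)

omit hP in
theorem weylGroup_apply_root {w : V ≃ₗ[ℝ] V} (hw : w ∈ weylGroup b) (i : ι) :
    w (P.root i) ∈ Set.range P.root := by
  induction hw using Subgroup.closure_induction'' generalizing i with
  | mem x hx =>
    obtain ⟨k, -, rfl⟩ := hx
    exact P.mapsTo_reflection_root k ⟨i, rfl⟩
  | inv_mem x hx =>
    obtain ⟨k, -, rfl⟩ := hx
    rw [P.reflection_inv]
    exact P.mapsTo_reflection_root k ⟨i, rfl⟩
  | one => exact ⟨i, rfl⟩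
  | mul x y _ _ hx hy =>
    obtain ⟨k, hk⟩ := hy i
    rw [LinearEquiv.mul_apply, ← hk]
    exact hx k

omit hP in
theorem weylGroup_apply_mem_rootLattice {w : V ≃ₗ[ℝ] V} (hw : w ∈ weylGroup b) {q : V}
    (hq : q ∈ rootLattice b) : w q ∈ rootLattice b := by
  induction hq using AddSubgroup.closure_induction with
  | mem x hx =>
    obtain ⟨k, -, rfl⟩ := hx
    obtain ⟨l, hl⟩ := weylGroup_apply_root b hw k
    rw [← hl]
    exact root_mem_rootLattice b l
  | zero => rw [map_zero]; exact zero_mem _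
  | add x y _ _ hx hy => rw [map_add]; exact add_mem hx hy
  | neg x _ hx => rw [map_neg]; exact neg_mem hx

theorem IsEuclidean.weylGroup_apply_mem_rootLattice_flip {w : V ≃ₗ[ℝ] V} (hw : w ∈ weylGroup b)
    {q : V} (hq : q ∈ rootLattice b.flip) : w q ∈ rootLattice b.flip :=
  weylGroup_apply_mem_rootLattice b.flip (by rwa [hP.weylGroup_flip b]) hq

theorem IsEuclidean.det_reflection [FiniteDimensional ℝ V] (i : ι) :
    LinearEquiv.det (P.reflection i) = -1 := by
  have h : P.reflection i = ((ℝ ∙ P.root i)ᗮ).reflection.toLinearEquiv := by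
    ext x
    have := Submodule.reflection_orthogonalComplement_singleton_eq_neg (𝕜 := ℝ) (P.root i)
    rw [hP.reflection_apply']
    simp only [LinearIsometryEquiv.coe_toLinearEquiv, Submodule.reflection_orthogonal_apply,
      Submodule.reflection_singleton_apply, hP.coroot_eq, real_inner_self_eq_norm_sq,
      real_inner_comm x]
    simp only [RCLike.ofReal_real_eq_id, id_eq]
    module
  rw [h, Submodule.linearEquiv_det_reflection, Submodule.orthogonal_orthogonal,
    finrank_span_singleton (P.ne_zero i), pow_one]

theorem IsEuclidean.det_weylGroup [FiniteDimensional ℝ V] {w : V ≃ₗ[ℝ] V}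
    (hw : w ∈ weylGroup b) : LinearEquiv.det w = 1 ∨ LinearEquiv.det w = -1 := by
  induction hw using Subgroup.closure_induction'' with
  | mem u hu =>
    obtain ⟨k, -, rfl⟩ := hu
    exact .inr (hP.det_reflection k)
  | inv_mem u hu =>
    obtain ⟨k, -, rfl⟩ := hu
    exact .inr (by rw [P.reflection_inv, hP.det_reflection k])
  | one => exact .inl (map_one _)
  | mul u v _ _ hu hv =>
    rw [map_mul]
    rcases hu with hu | hu <;> rcases hv with hv | hv <;> simp [hu, hv]

omit hP in
-- The fundamental coweights: the basis dual to the simple roots under the inner product.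
theorem exists_coweight_basis [DecidableEq ι] [P.IsRootSystem] :
    ∃ ω : Module.Basis b.support ℝ V, ∀ i j : b.support,
      ⟪ω i, P.root j⟫ = if i = j then 1 else 0 := by
  have hB : (innerₗ V).Nondegenerate :=
    ⟨fun x hx => inner_self_eq_zero.1 (hx x), fun x hx => inner_self_eq_zero.1 (hx x)⟩
  refine ⟨LinearMap.BilinForm.dualBasis (innerₗ V) hB b.toWeightBasis, fun i j => ?_⟩
  have := LinearMap.BilinForm.apply_dualBasis_left hB b.toWeightBasis i j
  rw [RootPairing.Base.toWeightBasis_apply, innerₗ_apply_apply] at this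
  rw [this]
  simp [eq_comm]

end Euclidean

/-! ### Affine roots and their reflections -/

section AffineReflections

variable {V : Type*} [NormedAddCommGroup V] [InnerProductSpace ℝ V] {ι : Type*}

/-- The affine functional `x ↦ ⟪x, α⟫ + k` attached to `(α, k)`. -/
def affVal (P : RootPairing ι ℝ V V) (a : ι × ℤ) (x : V) : ℝ := P.root' a.1 x + a.2

/-- The reflection in the zero set of `affVal P a`. -/
def affRefl (P : RootPairing ι ℝ V V) (a : ι × ℤ) : Equiv.Perm V :=
  Function.Involutive.toPerm (fun x => x - affVal P a x • P.coroot a.1) fun x => by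
    have : P.root' a.1 (P.coroot a.1) = 2 := P.root_coroot_two a.1
    simp only [affVal, map_sub, map_smul, this, smul_eq_mul]
    module

theorem affRefl_apply (P : RootPairing ι ℝ V V) (a : ι × ℤ) (x : V) :
    affRefl P a x = x - affVal P a x • P.coroot a.1 := rfl

theorem affRefl_affRefl (P : RootPairing ι ℝ V V) (a : ι × ℤ) (x : V) :
    affRefl P a (affRefl P a x) = x :=
  (affRefl P a).left_inv x

@[simp]
theorem affRefl_mul_self (P : RootPairing ι ℝ V V) (a : ι × ℤ) :
    affRefl P a * affRefl P a = 1 :=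
  Equiv.ext fun x => affRefl_affRefl P a x

@[simp]
theorem affRefl_inv (P : RootPairing ι ℝ V V) (a : ι × ℤ) : (affRefl P a)⁻¹ = affRefl P a := rfl

/-- The action of the reflection `affRefl P s` on the affine functionals `affVal P a`. -/
def affAct (P : RootPairing ι ℝ V V) [P.IsCrystallographic] (s a : ι × ℤ) : ι × ℤ :=
  (P.reflectionPerm s.1 a.1, a.2 - P.pairingIn ℤ a.1 s.1 * s.2)

variable (P : RootPairing ι ℝ V V) [P.IsCrystallographic]

theorem affVal_affAct (s a : ι × ℤ) (x : V) :
    affVal P (affAct P s a) x = affVal P a (affRefl P s x) := by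
  have h : P.root' (P.reflectionPerm s.1 a.1) x
      = P.root' a.1 x - P.pairing a.1 s.1 * P.root' s.1 x := by
    simp only [RootPairing.root', P.root_reflectionPerm, P.reflection_apply_root, map_sub,
      map_smul, LinearMap.sub_apply, LinearMap.smul_apply, smul_eq_mul]
  have h2 : (P.pairingIn ℤ a.1 s.1 : ℝ) = P.pairing a.1 s.1 := P.algebraMap_pairingIn ℤ _ _
  simp only [affVal, affAct, affRefl_apply, map_sub, map_smul, h, P.root'_coroot_eq_pairing,
    smul_eq_mul]
  push_cast
  rw [h2]
  ring

theorem affRefl_affAct (s a : ι × ℤ) :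
    affRefl P (affAct P s a) = affRefl P s * affRefl P a * affRefl P s := by
  ext x
  have h := affRefl_affRefl P s x
  have hc : P.coroot (P.reflectionPerm s.1 a.1)
      = P.coroot a.1 - P.root' s.1 (P.coroot a.1) • P.coroot s.1 := by
    rw [P.coroot_reflectionPerm, P.coreflection_apply]
  rw [affRefl_apply, affVal_affAct, Equiv.Perm.mul_apply, Equiv.Perm.mul_apply]
  conv_lhs => lhs; rw [← h]
  generalize affRefl P s x = y
  rw [affRefl_apply P a, affRefl_apply, affRefl_apply]
  simp only [affAct, hc, affVal, map_sub, map_smul, smul_eq_mul]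
  module

theorem affRefl_affAct_self (a : ι × ℤ) : affRefl P (affAct P a a) = affRefl P a := by
  rw [affRefl_affAct, affRefl_mul_self, one_mul]

theorem affVal_affAct_self (a : ι × ℤ) (x : V) :
    affVal P (affAct P a a) x = -affVal P a x := by
  have : P.root' a.1 (P.coroot a.1) = 2 := P.root_coroot_two a.1
  rw [affVal_affAct, affRefl_apply]
  simp only [affVal, map_sub, map_smul, this, smul_eq_mul]
  ring

end AffineReflections

/-! ### Heights and the highest root -/

section HighestRoot

variable {V : Type*} [NormedAddCommGroup V] [InnerProductSpace ℝ V] {ι : Type*}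
  {P : RootPairing ι ℝ V V} (b : P.Base)

/-- The sum of the fundamental coweights works. It turns membership in the cone of the simple roots
into inequalities between heights. -/
theorem exists_inner_eq_height [P.IsRootSystem] : ∃ ρ : V, ∀ i, ⟪ρ, P.root i⟫ = b.height i := by
  classical
  obtain ⟨ω, hω⟩ := exists_coweight_basis b
  refine ⟨∑ i, ω i, fun i => ?_⟩
  obtain ⟨f, -, -, hf⟩ := b.exists_root_eq_sum_int i
  rw [RootPairing.Base.height_eq_sum hf, hf, inner_sum, Int.cast_sum]
  refine Finset.sum_congr rfl fun j hj => ?_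
  rw [← Int.cast_smul_eq_zsmul ℝ, inner_smul_right, sum_inner]
  have := fun i => hω i ⟨j, hj⟩
  simp only at this
  simp [this]

variable {b} in
theorem inner_nonneg_of_mem_closure {x y : V} (hx : ∀ i ∈ b.support, 0 ≤ ⟪x, P.root i⟫)
    (hy : y ∈ AddSubmonoid.closure (P.root '' b.support)) : 0 ≤ ⟪x, y⟫ := by
  induction hy using AddSubmonoid.closure_induction with
  | mem y hy => obtain ⟨i, hi, rfl⟩ := hy; exact hx i hi
  | zero => rw [inner_zero_right]
  | add y z _ _ hy hz => rw [inner_add_right]; exact add_nonneg hy hz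

variable [P.IsRootSystem]

variable {b} in
theorem isPos_of_root_mem_closure {i : ι}
    (h : P.root i ∈ AddSubmonoid.closure (P.root '' b.support)) : b.IsPos i := by
  obtain ⟨ρ, hρ⟩ := exists_inner_eq_height b
  rw [RootPairing.Base.isPos_iff']
  have := inner_nonneg_of_mem_closure (x := ρ) (fun i hi => by
    rw [hρ, RootPairing.Base.height_one_of_mem_support hi]; norm_num) h
  rw [hρ] at this
  exact_mod_cast this

variable {b} in
theorem IsHighestRoot.height_le {ξ : ι} (hξ : IsHighestRoot b ξ) (i : ι) :
    b.height i ≤ b.height ξ := by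
  obtain ⟨ρ, hρ⟩ := exists_inner_eq_height b
  have := inner_nonneg_of_mem_closure (x := ρ) (fun i hi => by
    rw [hρ, RootPairing.Base.height_one_of_mem_support hi]; norm_num) (hξ i)
  rw [inner_sub_right, hρ, hρ] at this
  exact_mod_cast sub_nonneg.1 this

omit [P.IsRootSystem] in
variable {b} in
-- Maximality of ξ is applied to the root -α. This is how ⟨x,ξ⟩ ≤ 1 comes to bound every root from
-- below on the simplex.
theorem IsHighestRoot.add_mem {ξ : ι} (hξ : IsHighestRoot b ξ) (i : ι) :
    P.root ξ + P.root i ∈ AddSubmonoid.closure (P.root '' b.support) := by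
  have := hξ (P.reflectionPerm i i)
  rwa [P.root_reflectionPerm, P.reflection_apply_self, sub_neg_eq_add] at this

omit [P.IsRootSystem] in
theorem height_reflectionPerm_self' (i : ι) :
    b.height (P.reflectionPerm i i) = -b.height i :=
  b.height_reflectionPerm_self i

omit [P.IsRootSystem] in
theorem isPos_reflectionPerm_self (i : ι) :
    b.IsPos (P.reflectionPerm i i) ↔ ¬ b.IsPos i :=
  RootPairing.Base.IsPos.neg_iff_not b i

variable {b} in
theorem IsHighestRoot.height_pos {ξ : ι} (hξ : IsHighestRoot b ξ) : 0 < b.height ξ := by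
  have h := hξ.height_le (P.reflectionPerm ξ ξ)
  have h2 := b.height_ne_zero ξ
  rw [height_reflectionPerm_self'] at h
  lia

variable [Finite ι] [P.IsCrystallographic]

variable {b} in
-- If a simple root paired negatively with ξ, its sum with ξ would be a root of larger height.
theorem IsHighestRoot.pairingIn_nonneg {ξ : ι} (hξ : IsHighestRoot b ξ) {i : ι}
    (hi : b.IsPos i) : 0 ≤ P.pairingIn ℤ i ξ := by
  have key : ∀ i ∈ b.support, 0 ≤ P.pairingIn ℤ i ξ := by
    intro i hi
    by_contra! h
    have hne : P.root i ≠ -P.root ξ := by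
      intro h'
      have h1 : P.root i = P.root (P.reflectionPerm ξ ξ) := by simpa using h'
      have h2 := height_reflectionPerm_self' b ξ
      rw [← P.root.injective h1, RootPairing.Base.height_one_of_mem_support hi] at h2
      have := hξ.height_pos
      lia
    obtain ⟨k, hk⟩ := P.root_add_root_mem_of_pairingIn_neg h hne
    have h1 := b.height_add hk
    have h2 := hξ.height_le k
    rw [RootPairing.Base.height_one_of_mem_support hi] at h1
    lia
  refine hi.induction_on_add key fun i j k hk hi hj => ?_
  rw [P.pairingIn_eq_add_of_root_eq_add hk]
  exact add_nonneg hi (key j hj)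

omit [Finite ι] in
variable {b} in
-- If the pairing p were at least 2, the root -r_ξ(α) = pξ - α of height at most ht ξ would force ht
-- α = ht ξ. Then ξ - α is a sum of simple roots of height 0, hence zero.
theorem IsHighestRoot.pairingIn_le_one {ξ : ι} (hξ : IsHighestRoot b ξ) {i : ι}
    (hi : i ≠ ξ) : P.pairingIn ℤ i ξ ≤ 1 := by
  by_contra! h
  obtain ⟨ρ, hρ⟩ := exists_inner_eq_height b
  have hk := P.root_reflectionPerm ξ i
  rw [P.reflection_apply_root' ℤ, sub_eq_add_neg, ← neg_smul] at hk
  have h1 := b.height_add_zsmul hk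
  have h2 := hξ.height_le (P.reflectionPerm (P.reflectionPerm ξ i) (P.reflectionPerm ξ i))
  rw [height_reflectionPerm_self', h1] at h2
  have h3 := hξ.height_le i
  have h4 := hξ.height_pos
  have h5 : b.height i = b.height ξ := by
    simp only [smul_eq_mul] at h2
    nlinarith
  have h6 : ∀ x ∈ AddSubmonoid.closure (P.root '' b.support), x = 0 ∨ 0 < ⟪ρ, x⟫ := by
    intro x hx
    induction hx using AddSubmonoid.closure_induction with
    | mem y hy =>
      obtain ⟨i, hi, rfl⟩ := hy
      right
      rw [hρ, RootPairing.Base.height_one_of_mem_support hi]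
      norm_num
    | zero => exact .inl rfl
    | add y z _ _ hy hz =>
      rw [inner_add_right]
      rcases hy with rfl | hy
      · simpa using hz
      · rcases hz with rfl | hz
        · simpa using Or.inr hy
        · exact .inr (add_pos hy hz)
  rcases h6 _ (hξ i) with h7 | h7
  · exact hi (P.root.injective (sub_eq_zero.1 h7).symm)
  · rw [inner_sub_right, hρ, hρ, h5] at h7
    simp at h7

end HighestRoot

/-! ### Positive affine roots -/

section AffineRoots

variable {V : Type*} [NormedAddCommGroup V] [InnerProductSpace ℝ V] {ι : Type*}
  {P : RootPairing ι ℝ V V} (b : P.Base)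

/-- `affVal P a` is positive on the open simplex. -/
def IsPosAff (a : ι × ℤ) : Prop := 0 < a.2 ∨ a.2 = 0 ∧ b.IsPos a.1

/-- `a` is one of the functionals cutting out the simplex. -/
def IsSimpleAff (ξ : ι) (a : ι × ℤ) : Prop :=
  (a.1 ∈ b.support ∧ a.2 = 0) ∨ a = (P.reflectionPerm ξ ξ, 1)

variable {b} in
theorem IsSimpleAff.isPosAff {ξ : ι} {a : ι × ℤ} (ha : IsSimpleAff b ξ a) : IsPosAff b a := by
  rcases ha with ⟨h, h'⟩ | rfl
  · exact .inr ⟨h', RootPairing.Base.isPos_of_mem_support h⟩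
  · exact .inl one_pos

variable [P.IsCrystallographic]

/-- Reflecting a in itself gives -a: the level k becomes k - 2k. -/
theorem isPosAff_affAct_self (a : ι × ℤ) : IsPosAff b (affAct P a a) ↔ ¬ IsPosAff b a := by
  simp only [IsPosAff, affAct, isPos_reflectionPerm_self, P.pairingIn_same]
  rcases lt_trichotomy a.2 0 with h | h | h
  · have h1 : 0 < a.2 - 2 * a.2 := by lia
    have h2 : ¬ 0 < a.2 := by lia
    have h3 := h.ne
    tauto
  · simp [h]
  · have h1 : ¬ 0 < a.2 - 2 * a.2 := by lia
    have h2 : a.2 - 2 * a.2 ≠ 0 := by lia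
    tauto

variable [P.IsRootSystem] [Finite ι] [P.IsReduced]

/-- Affine form of the fact that a simple reflection permutes the positive roots other than its own.
The reflection in 1 - ξ changes the level m of (α, m) to m + ⟨α,ξ^∨⟩, and the bounds on pairings
with ξ control the new level. -/
theorem IsHighestRoot.isPosAff_affAct {ξ : ι} (hξ : IsHighestRoot b ξ) {s a : ι × ℤ}
    (hs : IsSimpleAff b ξ s) (ha : IsPosAff b a) (hne : a ≠ s) : IsPosAff b (affAct P s a) := by
  obtain ⟨j, m⟩ := a
  rcases hs with ⟨h, h'⟩ | rfl
  · obtain ⟨i, k⟩ := s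
    simp only at h h'
    subst h'
    rcases ha with ha | ⟨ha, ha'⟩
    · exact .inl (by simpa [affAct] using ha)
    · simp only at ha ha'
      subst ha
      exact .inr ⟨by simp [affAct], ha'.reflectionPerm h fun hij => hne (by rw [hij])⟩
  · have hp := P.pairingIn_reflectionPerm_self_right ℤ j ξ
    -- For α = -ξ the level drops by 2; m = 1 is s itself, and m = 2 leads to ξ at level 0.
    by_cases hjξ : j = P.reflectionPerm ξ ξ
    · subst hjξ
      have h1 : ¬ b.IsPos (P.reflectionPerm ξ ξ) := by
        rw [isPos_reflectionPerm_self, not_not]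
        exact hξ.height_pos
      have hm : 0 < m := ha.resolve_right fun h => h1 h.2
      have hm' : m ≠ 1 := fun h => hne (by rw [h])
      rcases (show 2 < m ∨ m = 2 by lia) with h | h
      · refine .inl ?_
        simp only [affAct, P.pairingIn_same]
        lia
      · refine .inr ⟨?_, ?_⟩
        · simp [affAct, h]
        · simp only [affAct, isPos_reflectionPerm_self, not_not]
          exact hξ.height_pos
    · simp only [IsPosAff] at ha
      simp only [IsPosAff, affAct, hp]
      by_cases hj : b.IsPos j
      · have h1 := hξ.pairingIn_nonneg hj
        rcases (show 0 < m - -P.pairingIn ℤ j ξ * 1 ∨ (m = 0 ∧ P.pairingIn ℤ j ξ = 0) by lia)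
          with h | ⟨h, h2⟩
        · exact .inl h
        · refine .inr ⟨by lia, ?_⟩
          rw [P.reflectionPerm_eq_of_pairing_eq_zero]
          · exact hj
          · rw [← P.algebraMap_pairingIn ℤ, P.pairingIn_reflectionPerm_self_right, h2]; simp
      · have hm : 0 < m := by tauto
        have h1 := hξ.pairingIn_le_one (i := P.reflectionPerm j j) (by
          intro h
          refine hjξ (P.root.injective ?_)
          rw [P.root_reflectionPerm, P.reflection_apply_self, ← h, P.root_reflectionPerm,
            P.reflection_apply_self, neg_neg])
        rw [P.pairingIn_reflectionPerm_self_left] at h1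
        -- For a negative root other than -ξ the pairing is at least -1. The new level is 0 only in
        -- the second case, where the new root is ξ + α, a sum of simple roots.
        rcases (show 0 < m - -P.pairingIn ℤ j ξ * 1 ∨ (m = 1 ∧ P.pairingIn ℤ j ξ = -1) by lia)
          with h | ⟨h, h2⟩
        · exact .inl h
        · refine .inr ⟨by lia, isPos_of_root_mem_closure ?_⟩
          have h3 := P.root_reflectionPerm (P.reflectionPerm ξ ξ) j
          rw [P.reflection_apply_root' ℤ, P.pairingIn_reflectionPerm_self_right, h2,
            P.root_reflectionPerm ξ ξ, P.reflection_apply_self] at h3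
          rw [h3]
          convert! hξ.add_mem j using 1
          module

end AffineRoots

/-! ### Signs of affine roots on the simplex -/

section Alcove

variable {V : Type*} [NormedAddCommGroup V] [InnerProductSpace ℝ V] {ι : Type*}
  {P : RootPairing ι ℝ V V} (b : P.Base)

theorem IsEuclidean.affVal_eq (hP : IsEuclidean P) (a : ι × ℤ) (x : V) :
    affVal P a x = ⟪x, P.root a.1⟫ + a.2 := by
  rw [affVal, real_inner_comm, ← hP.toLinearMap_apply]

theorem IsEuclidean.mem_simplex_iff (hP : IsEuclidean P) {ξ : ι} {x : V} :
    x ∈ simplex b ξ ↔ ∀ s, IsSimpleAff b ξ s → 0 ≤ affVal P s x := by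
  constructor
  · rintro ⟨h1, h2⟩ ⟨i, k⟩ (⟨h, h'⟩ | h)
    · simp only at h h'
      rw [hP.affVal_eq]
      simpa [h'] using h1 i h
    · rw [h, hP.affVal_eq]
      simp only [P.root_reflectionPerm, P.reflection_apply_self, inner_neg_right, Int.cast_one]
      linarith
  · intro h
    constructor
    · intro i hi
      have := h (i, 0) (.inl ⟨hi, rfl⟩)
      simpa [hP.affVal_eq] using this
    · have := h _ (.inr rfl)
      simp only [hP.affVal_eq, P.root_reflectionPerm, P.reflection_apply_self, inner_neg_right,
        Int.cast_one] at this
      linarith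

theorem IsEuclidean.mem_openSimplex_iff (hP : IsEuclidean P) {ξ : ι} {x : V} :
    x ∈ openSimplex b ξ ↔ ∀ s, IsSimpleAff b ξ s → 0 < affVal P s x := by
  constructor
  · rintro ⟨h1, h2⟩ ⟨i, k⟩ (⟨h, h'⟩ | h)
    · simp only at h h'
      rw [hP.affVal_eq]
      simpa [h'] using h1 i h
    · rw [h, hP.affVal_eq]
      simp only [P.root_reflectionPerm, P.reflection_apply_self, inner_neg_right, Int.cast_one]
      linarith
  · intro h
    constructor
    · intro i hi
      have := h (i, 0) (.inl ⟨hi, rfl⟩)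
      simpa [hP.affVal_eq] using this
    · have := h _ (.inr rfl)
      simp only [hP.affVal_eq, P.root_reflectionPerm, P.reflection_apply_self, inner_neg_right,
        Int.cast_one] at this
      linarith

theorem openSimplex_subset (ξ : ι) : openSimplex b ξ ⊆ simplex b ξ :=
  fun _ h => ⟨fun i hi => (h.1 i hi).le, h.2.le⟩

variable [Finite ι] [P.IsCrystallographic]

/-- At levels k ≥ 1, ξ + α lies in the cone of the simple roots, so ⟨x,α⟩ ≥ -⟨x,ξ⟩ ≥ -1. At level 0
the root is a sum of simple roots. -/
theorem IsEuclidean.affVal_nonneg (hP : IsEuclidean P) {ξ : ι} (hξ : IsHighestRoot b ξ)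
    {x : V} (hx : x ∈ simplex b ξ) {a : ι × ℤ} (ha : IsPosAff b a) : 0 ≤ affVal P a x := by
  rw [hP.affVal_eq]
  rcases ha with ha | ⟨ha, ha'⟩
  · have h1 := inner_nonneg_of_mem_closure hx.1 (hξ.add_mem a.1)
    have h2 : (1 : ℝ) ≤ a.2 := by exact_mod_cast ha
    have h3 := hx.2
    rw [inner_add_right] at h1
    linarith
  · rw [ha, Int.cast_zero, add_zero]
    refine ha'.induction_on_add hx.1 fun i j k hk hi hj => ?_
    rw [hk, inner_add_right]
    exact add_nonneg hi (hx.1 j hj)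

theorem IsEuclidean.affVal_pos (hP : IsEuclidean P) {ξ : ι} (hξ : IsHighestRoot b ξ)
    {x : V} (hx : x ∈ openSimplex b ξ) {a : ι × ℤ} (ha : IsPosAff b a) : 0 < affVal P a x := by
  rw [hP.affVal_eq]
  rcases ha with ha | ⟨ha, ha'⟩
  · have h1 := inner_nonneg_of_mem_closure (fun i hi => (hx.1 i hi).le) (hξ.add_mem a.1)
    have h2 : (1 : ℝ) ≤ a.2 := by exact_mod_cast ha
    have h3 := hx.2
    rw [inner_add_right] at h1
    linarith
  · rw [ha, Int.cast_zero, add_zero]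
    refine ha'.induction_on_add hx.1 fun i j k hk hi hj => ?_
    rw [hk, inner_add_right]
    exact add_pos hi (hx.1 j hj)

omit [Finite ι] [P.IsCrystallographic] in
theorem openSimplex_nonempty [P.IsRootSystem] {ξ : ι} (hξ : IsHighestRoot b ξ) :
    (openSimplex b ξ).Nonempty := by
  obtain ⟨ρ, hρ⟩ := exists_inner_eq_height b
  have h : (0 : ℝ) < b.height ξ := by exact_mod_cast hξ.height_pos
  -- Dividing by ht ξ + 1 makes the value of ξ equal to ht ξ / (ht ξ + 1) < 1.
  refine ⟨((b.height ξ : ℝ) + 1)⁻¹ • ρ, fun i hi => ?_, ?_⟩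
  · rw [inner_smul_left, hρ, RootPairing.Base.height_one_of_mem_support hi]
    simp only [conj_trivial]
    positivity
  · rw [inner_smul_left, hρ]
    simp only [conj_trivial]
    rw [inv_mul_lt_iff₀ (by positivity)]
    linarith

end Alcove

/-! ### The wall reflections generate the affine Weyl group -/

section Generation

variable {V : Type*} [NormedAddCommGroup V] [InnerProductSpace ℝ V] {ι : Type*}
  {P : RootPairing ι ℝ V V} (b : P.Base)

/-- The affine Weyl group, generated by the reflections in the walls of the simplex. -/
def affineWeylGroup (ξ : ι) : Subgroup (Equiv.Perm V) :=
  Subgroup.closure (affRefl P '' {s | IsSimpleAff b ξ s})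

/-- The affine extension of the height. -/
def affHeight (ξ : ι) (a : ι × ℤ) : ℤ := b.height a.1 + a.2 * (b.height ξ + 1)

variable [P.IsRootSystem] [P.IsCrystallographic]

omit [P.IsCrystallographic] in
theorem IsHighestRoot.affHeight_pos {ξ : ι} (hξ : IsHighestRoot b ξ) {a : ι × ℤ}
    (ha : IsPosAff b a) : 0 < affHeight b ξ a := by
  rcases ha with ha | ⟨ha, ha'⟩
  · have h1 := hξ.height_le (P.reflectionPerm a.1 a.1)
    have h2 := hξ.height_pos
    rw [height_reflectionPerm_self'] at h1
    unfold affHeight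
    nlinarith
  · rw [affHeight, ha, zero_mul, add_zero]
    exact ha'

omit [P.IsRootSystem] in
-- The weight ht ξ + 1 of the level gives every wall functional, including 1 - ξ, affine height 1.
theorem affHeight_affAct {ξ : ι} {s : ι × ℤ} (hs : IsSimpleAff b ξ s) (a : ι × ℤ) :
    affHeight b ξ (affAct P s a) = affHeight b ξ a - P.pairingIn ℤ a.1 s.1 := by
  have hk := P.root_reflectionPerm s.1 a.1
  rw [P.reflection_apply_root' ℤ, sub_eq_add_neg, ← neg_smul] at hk
  have h1 := b.height_add_zsmul hk
  simp only [affHeight, affAct, h1]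
  rcases hs with ⟨h, h'⟩ | rfl
  · rw [RootPairing.Base.height_one_of_mem_support h, h']
    simp only [smul_eq_mul]
    ring
  · simp only [height_reflectionPerm_self', smul_eq_mul]
    ring

omit [P.IsRootSystem] in
-- At positive level, if no wall paired positively with α, then -α would be dominant and ⟨α,ξ⟩ ≥ 0.
-- Pairing -α with ξ + α gives 0 ≤ -⟨α,ξ⟩ - |α|², which is absurd.
theorem IsEuclidean.exists_pairingIn_pos (hP : IsEuclidean P) [Finite ι] {ξ : ι}
    (hξ : IsHighestRoot b ξ) {a : ι × ℤ} (ha : IsPosAff b a) :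
    ∃ s, IsSimpleAff b ξ s ∧ 0 < P.pairingIn ℤ a.1 s.1 := by
  rcases ha with ha | ⟨ha, ha'⟩
  · by_contra! h
    have h1 : ∀ i, P.pairingIn ℤ a.1 i ≤ 0 → ⟪P.root a.1, P.root i⟫ ≤ 0 := by
      intro i hi
      have h2 : (P.pairingIn ℤ a.1 i : ℝ) = P.pairing a.1 i := P.algebraMap_pairingIn ℤ _ _
      have h3 : P.pairing a.1 i ≤ 0 := by rw [← h2]; exact_mod_cast hi
      rw [← hP.inner_root_coroot, hP.coroot_eq, inner_smul_right] at h3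
      have := inner_root_self_pos P i
      have h4 : 0 < 2 / ⟪P.root i, P.root i⟫ := by positivity
      nlinarith
    have h2 := inner_nonneg_of_mem_closure (x := -P.root a.1) (fun i hi => by
      rw [inner_neg_left]
      have := h1 i (h (i, 0) (.inl ⟨hi, rfl⟩))
      linarith) (hξ.add_mem a.1)
    have h3 := h1 _ (h _ (.inr rfl))
    have h4 := inner_root_self_pos P a.1
    rw [P.root_reflectionPerm, P.reflection_apply_self, inner_neg_right] at h3
    rw [inner_neg_left, inner_add_right] at h2
    linarith
  · obtain ⟨j, hj, hj'⟩ := ha'.exists_mem_support_pos_pairingIn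
    exact ⟨(j, 0), .inl ⟨hj, rfl⟩, (P.zero_lt_pairingIn_iff' ℤ).1 hj'⟩

variable [Finite ι] [P.IsReduced]

/-- Induction on the affine height: conjugating by a wall reflection that pairs positively with a
lowers the height and keeps a positive, unless a is that wall. A negative a has the same reflection
as -a. -/
theorem IsEuclidean.affRefl_mem (hP : IsEuclidean P) {ξ : ι} (hξ : IsHighestRoot b ξ)
    (a : ι × ℤ) : affRefl P a ∈ affineWeylGroup b ξ := by
  have key : ∀ (n : ℕ) (a : ι × ℤ), IsPosAff b a → (affHeight b ξ a).toNat = n →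
      affRefl P a ∈ affineWeylGroup b ξ := by
    intro n
    induction n using Nat.strong_induction_on with
    | _ n ih =>
      intro a ha hn
      obtain ⟨s, hs, hp⟩ := hP.exists_pairingIn_pos b hξ ha
      have hs' : affRefl P s ∈ affineWeylGroup b ξ := Subgroup.subset_closure ⟨s, hs, rfl⟩
      by_cases has : a = s
      · rwa [has]
      · have h1 := hξ.isPosAff_affAct b hs ha has
        have h2 := hξ.affHeight_pos b ha
        have h3 := affHeight_affAct b hs a
        have h4 := ih _ (by lia) _ h1 rfl
        rw [affRefl_affAct] at h4
        have := mul_mem (mul_mem hs' h4) hs'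
        simpa [mul_assoc, ← mul_assoc (affRefl P s) (affRefl P s)] using this
  by_cases ha : IsPosAff b a
  · exact key _ a ha rfl
  · rw [← affRefl_affAct_self]
    exact key _ _ ((isPosAff_affAct_self b a).2 ha) rfl

/-- The affine map `x ↦ w x + q`. -/
def affMap (w : V ≃ₗ[ℝ] V) (q : V) : Equiv.Perm V := w.toEquiv.trans (Equiv.addRight q)

omit [P.IsRootSystem] [P.IsCrystallographic] [Finite ι] [P.IsReduced] in
theorem affMap_apply (w : V ≃ₗ[ℝ] V) (q x : V) : affMap w q x = w x + q := rfl

theorem IsEuclidean.affMap_mem (hP : IsEuclidean P) {ξ : ι} (hξ : IsHighestRoot b ξ)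
    {w : V ≃ₗ[ℝ] V} (hw : w ∈ weylGroup b) {q : V} (hq : q ∈ rootLattice b.flip) :
    affMap w q ∈ affineWeylGroup b ξ := by
  have hr : ∀ k, affMap (P.reflection k) 0 = affRefl P (k, 0) := by
    intro k
    ext x
    simp [affMap_apply, affRefl_apply, hP.affVal_eq, hP.reflection_apply']
  have h1 : affMap w 0 ∈ affineWeylGroup b ξ := by
    induction hw using Subgroup.closure_induction'' with
    | mem u hu =>
      obtain ⟨k, -, rfl⟩ := hu
      rw [hr]
      exact hP.affRefl_mem b hξ _
    | inv_mem u hu =>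
      obtain ⟨k, -, rfl⟩ := hu
      rw [P.reflection_inv, hr]
      exact hP.affRefl_mem b hξ _
    | one =>
      convert! one_mem (affineWeylGroup b ξ)
      ext x
      simp [affMap_apply]
    | mul u v _ _ hu hv =>
      convert! mul_mem hu hv
      ext x
      simp [affMap_apply]
  have h2 : Equiv.addRight q ∈ affineWeylGroup b ξ := by
    induction hq using AddSubgroup.closure_induction with
    | mem x hx =>
      obtain ⟨k, -, rfl⟩ := hx
      -- Translation by a coroot is the product of the reflections in two parallel hyperplanes.
      convert! mul_mem (hP.affRefl_mem b hξ (k, -1)) (hP.affRefl_mem b hξ (k, 0))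
      ext x
      have h2 : ⟪P.coroot k, P.root k⟫ = 2 := by rw [hP.inner_coroot_root, P.pairing_same]
      simp only [Equiv.coe_addRight, Equiv.Perm.mul_apply, affRefl_apply, hP.affVal_eq,
        inner_sub_left, inner_smul_left, h2, RootPairing.flip_root]
      simp
      module
    | zero =>
      convert! one_mem (affineWeylGroup b ξ)
      ext x
      simp
    | add x y _ _ hx hy =>
      convert! mul_mem hy hx
      ext z
      simp [add_assoc]
    | neg x _ hx =>
      convert! inv_mem hx
      ext z
      simp
  convert! mul_mem h2 h1
  ext x
  simp [affMap_apply]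

end Generation

/-! ### Exchange condition; the simplex meets each orbit at most once -/

section Uniqueness

variable {V : Type*} [NormedAddCommGroup V] [InnerProductSpace ℝ V] {ι : Type*}
  {P : RootPairing ι ℝ V V} (b : P.Base)

theorem exists_list_of_mem_affineWeylGroup {ξ : ι} {g : Equiv.Perm V}
    (hg : g ∈ affineWeylGroup b ξ) :
    ∃ L : List (ι × ℤ), (∀ s ∈ L, IsSimpleAff b ξ s) ∧ (L.map (affRefl P)).prod = g := by
  induction hg using Subgroup.closure_induction'' with
  | mem x hx =>
    obtain ⟨s, hs, rfl⟩ := hx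
    exact ⟨[s], by simpa using hs, by simp⟩
  | inv_mem x hx =>
    obtain ⟨s, hs, rfl⟩ := hx
    exact ⟨[s], by simpa using hs, by simp⟩
  | one => exact ⟨[], by simp, by simp⟩
  | mul x y _ _ hx hy =>
    obtain ⟨L, hL, rfl⟩ := hx
    obtain ⟨L', hL', rfl⟩ := hy
    refine ⟨L ++ L', fun s hs => ?_, by simp⟩
    rcases List.mem_append.1 hs with h | h
    exacts [hL s h, hL' s h]

variable [P.IsCrystallographic]

/-- The left fold pulls a functional back along the word, the outermost letter first. -/
theorem affVal_foldl_affAct (L : List (ι × ℤ)) (a : ι × ℤ) (x : V) :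
    affVal P (L.foldl (fun a s => affAct P s a) a) x = affVal P a ((L.map (affRefl P)).prod x) := by
  induction L generalizing a with
  | nil => rfl
  | cons s L ih =>
    rw [List.foldl_cons, ih, affVal_affAct, List.map_cons, List.prod_cons, Equiv.Perm.mul_apply]

variable [Finite ι]

theorem IsEuclidean.isPosAff_iff (hP : IsEuclidean P) {ξ : ι} (hξ : IsHighestRoot b ξ)
    {x : V} (hx : x ∈ openSimplex b ξ) {a : ι × ℤ} : IsPosAff b a ↔ 0 < affVal P a x := by
  refine ⟨hP.affVal_pos b hξ hx, fun h => ?_⟩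
  by_contra h'
  have := hP.affVal_pos b hξ hx ((isPosAff_affAct_self b a).2 h')
  rw [affVal_affAct_self] at this
  linarith

variable [P.IsRootSystem] [P.IsReduced]

/-- The exchange condition for words in the reflections in the walls. -/
theorem IsHighestRoot.exists_exchange {ξ : ι} (hξ : IsHighestRoot b ξ) (L : List (ι × ℤ))
    (hL : ∀ s ∈ L, IsSimpleAff b ξ s) (a : ι × ℤ) (ha : IsPosAff b a)
    (ha' : ¬ IsPosAff b (L.foldl (fun a s => affAct P s a) a)) :
    ∃ L' : List (ι × ℤ), (∀ s ∈ L', IsSimpleAff b ξ s) ∧ L'.length + 1 = L.length ∧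
      affRefl P a * (L.map (affRefl P)).prod = (L'.map (affRefl P)).prod := by
  induction L generalizing a with
  | nil => exact absurd ha ha'
  | cons s L ih =>
    have hL1 : ∀ s ∈ L, IsSimpleAff b ξ s := fun t ht => hL t (List.mem_cons_of_mem _ ht)
    have hs : IsSimpleAff b ξ s := hL s List.mem_cons_self
    -- A letter s makes a positive functional negative only if that functional is s. This letter is
    -- the one deleted; conjugation carries the deletion past the letters before it.
    by_cases has : a = s
    · refine ⟨L, hL1, rfl, ?_⟩
      rw [has, List.map_cons, List.prod_cons, ← mul_assoc, affRefl_mul_self, one_mul]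
    · obtain ⟨L', h1, h2, h3⟩ := ih hL1 _ (hξ.isPosAff_affAct b hs ha has) ha'
      refine ⟨s :: L', fun t ht => ?_, by simp [h2], ?_⟩
      · rcases List.mem_cons.1 ht with rfl | ht
        exacts [hs, h1 t ht]
      · rw [List.map_cons, List.prod_cons, List.map_cons, List.prod_cons, ← h3, affRefl_affAct]
        simp only [← mul_assoc, affRefl_mul_self, one_mul]

/-- Induction on the length of the word g = s·L. If the functional s pulled back along g stays
positive, it is negative along L and the exchange condition shortens g. Otherwise s is both ≤ 0 and
≥ 0 at g y, so g y lies on the wall of s and equals L y. The second case cannot occur for y in the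
open simplex. -/
theorem IsEuclidean.eq_of_mem_simplex_aux (hP : IsEuclidean P) {ξ : ι}
    (hξ : IsHighestRoot b ξ) (n : ℕ) (L : List (ι × ℤ)) (hn : L.length = n)
    (hL : ∀ s ∈ L, IsSimpleAff b ξ s) {y : V} (hy : y ∈ simplex b ξ)
    (hy' : (L.map (affRefl P)).prod y ∈ simplex b ξ) :
    (L.map (affRefl P)).prod y = y ∧ (y ∈ openSimplex b ξ → (L.map (affRefl P)).prod = 1) := by
  obtain ⟨x₀, hx₀⟩ := openSimplex_nonempty b hξ
  induction n using Nat.strong_induction_on generalizing L with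
  | _ n ih =>
    match L, hn with
    | [], _ => simp
    | s :: L, hn =>
      rw [List.length_cons] at hn
      have hL1 : ∀ s ∈ L, IsSimpleAff b ξ s := fun t ht => hL t (List.mem_cons_of_mem _ ht)
      have hs : IsSimpleAff b ξ s := hL s List.mem_cons_self
      have hpull := affVal_foldl_affAct (P := P) (s :: L) s
      by_cases hpos : IsPosAff b ((s :: L).foldl (fun a s => affAct P s a) s)
      · have hneg : ¬ IsPosAff b (L.foldl (fun a s => affAct P s a) s) := by
          intro h
          rw [hP.isPosAff_iff b hξ hx₀] at h hpos
          rw [List.foldl_cons, affVal_foldl_affAct, affVal_affAct_self,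
            ← affVal_foldl_affAct] at hpos
          linarith
        obtain ⟨L', h1, h2, h3⟩ := hξ.exists_exchange b L hL1 s hs.isPosAff hneg
        have h4 : ((s :: L).map (affRefl P)).prod = (L'.map (affRefl P)).prod := by
          rw [List.map_cons, List.prod_cons, h3]
        rw [h4] at hy' ⊢
        exact ih L'.length (by lia) L' rfl h1 hy'
      · have hneg := (isPosAff_affAct_self b _).2 hpos
        have h0 := (hP.mem_simplex_iff b).1 hy' s hs
        have h1 := hP.affVal_nonneg b hξ hy hneg
        rw [affVal_affAct_self, hpull] at h1
        have h2 : affVal P s (((s :: L).map (affRefl P)).prod y) = 0 := by linarith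
        have h3 : (L.map (affRefl P)).prod y = ((s :: L).map (affRefl P)).prod y := by
          have h4 : affRefl P s (((s :: L).map (affRefl P)).prod y)
              = ((s :: L).map (affRefl P)).prod y := by
            rw [affRefl_apply, h2, zero_smul, sub_zero]
          rw [← h4, List.map_cons, List.prod_cons, Equiv.Perm.mul_apply, affRefl_affRefl]
        constructor
        · rw [← h3]
          exact (ih L.length (by lia) L rfl hL1 (by rwa [h3])).1
        · intro hyo
          have h5 := hP.affVal_pos b hξ hyo hneg
          rw [affVal_affAct_self, hpull, h2] at h5
          simp at h5

/-- The simplex meets every orbit of the affine Weyl group at most once. -/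
theorem IsEuclidean.eq_of_mem_simplex (hP : IsEuclidean P) {ξ : ι} (hξ : IsHighestRoot b ξ)
    {w : V ≃ₗ[ℝ] V} (hw : w ∈ weylGroup b) {q : V} (hq : q ∈ rootLattice b.flip) {y : V}
    (hy : y ∈ simplex b ξ) (hy' : w y + q ∈ simplex b ξ) : w y + q = y := by
  obtain ⟨L, hL, h⟩ := exists_list_of_mem_affineWeylGroup b (hP.affMap_mem b hξ hw hq)
  have := (hP.eq_of_mem_simplex_aux b hξ _ L rfl hL hy (by rwa [h, affMap_apply])).1
  rwa [h, affMap_apply] at this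

/-- The affine Weyl group acts freely on the orbit of the open simplex. -/
theorem IsEuclidean.eq_one_of_mem_openSimplex (hP : IsEuclidean P) {ξ : ι}
    (hξ : IsHighestRoot b ξ) {w : V ≃ₗ[ℝ] V} (hw : w ∈ weylGroup b) {q : V}
    (hq : q ∈ rootLattice b.flip) {y : V} (hy : y ∈ openSimplex b ξ)
    (hy' : w y + q ∈ simplex b ξ) : w = 1 := by
  obtain ⟨L, hL, h⟩ := exists_list_of_mem_affineWeylGroup b (hP.affMap_mem b hξ hw hq)
  have := (hP.eq_of_mem_simplex_aux b hξ _ L rfl hL (openSimplex_subset b ξ hy)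
    (by rwa [h, affMap_apply])).2 hy
  rw [h] at this
  have h2 := fun x => congrArg (fun g : Equiv.Perm V => g x) this
  simp only [affMap_apply, Equiv.Perm.one_apply] at h2
  -- Evaluating the identity map at 0 gives q = 0.
  have h3 := h2 0
  rw [map_zero, zero_add] at h3
  ext x
  have := h2 x
  rwa [h3, add_zero] at this

end Uniqueness

section Reflections

variable {V : Type*} [NormedAddCommGroup V] [InnerProductSpace ℝ V] {ι : Type*}
  {P : RootPairing ι ℝ V V} (b : P.Base) [P.IsCrystallographic] [Finite ι] [P.IsReduced]

theorem reflection_mem_weylGroup (i : ι) : P.reflection i ∈ weylGroup b := by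
  refine b.induction_reflect i (p := fun i => P.reflection i ∈ weylGroup b) (fun i hi => ?_)
    (fun i hi => Subgroup.subset_closure ⟨i, hi, rfl⟩) (fun i j hi hj => ?_)
  · rw [P.reflection_reflectionPerm]
    exact mul_mem (mul_mem hi hi) hi
  · have hj : P.reflection j ∈ weylGroup b := Subgroup.subset_closure ⟨j, hj, rfl⟩
    rw [P.reflection_reflectionPerm]
    exact mul_mem (mul_mem hj hi) hj

end Reflections

/-! ### Every orbit meets the simplex -/

section Existence

variable {V : Type*} [NormedAddCommGroup V] [InnerProductSpace ℝ V] {ι : Type*}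
  {P : RootPairing ι ℝ V V} (b : P.Base)

theorem coe_rootLattice [P.IsRootSystem] : (rootLattice b : Set V)
    = (Submodule.span ℤ (Set.range b.toWeightBasis) : Set V) := by
  have : Set.range b.toWeightBasis = P.root '' b.support := by
    ext x
    simp
  rw [this, rootLattice, ← Submodule.span_int_eq_addSubgroupClosure]
  rfl

theorem finite_rootLattice_inter [P.IsRootSystem] {s : Set V} (hs : Bornology.IsBounded s) :
    (s ∩ rootLattice b).Finite := by
  have : FiniteDimensional ℝ V := Module.Finite.of_basis b.toWeightBasis
  rw [coe_rootLattice]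
  exact ZSpan.setFinite_inter b.toWeightBasis hs

/-- The points y and x₀ lie on opposite sides of the hyperplane: the squared distance changes by 4
a(y) a(x₀) / |α|² < 0. -/
theorem IsEuclidean.dist_affRefl_lt (hP : IsEuclidean P) {a : ι × ℤ} {x₀ y : V}
    (hx₀ : 0 < affVal P a x₀) (hy : affVal P a y < 0) : ‖affRefl P a y - x₀‖ < ‖y - x₀‖ := by
  refine lt_of_pow_lt_pow_left₀ 2 (norm_nonneg _) ?_
  have h : affRefl P a y - x₀ = (y - x₀) - affVal P a y • P.coroot a.1 := by
    rw [affRefl_apply]; abel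
  have h0 := inner_root_self_pos P a.1
  have h1 : ⟪y - x₀, P.root a.1⟫ = affVal P a y - affVal P a x₀ := by
    rw [hP.affVal_eq, hP.affVal_eq, inner_sub_left]; ring
  have h2 : ‖affRefl P a y - x₀‖ ^ 2 = ‖y - x₀‖ ^ 2
      + 4 / ⟪P.root a.1, P.root a.1⟫ * (affVal P a y * affVal P a x₀) := by
    rw [h, norm_sub_sq_real, inner_smul_right, norm_smul, mul_pow, ← real_inner_self_eq_norm_sq
      (P.coroot a.1), hP.coroot_eq, inner_smul_right, h1, inner_smul_left, inner_smul_right,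
      Real.norm_eq_abs, sq_abs]
    simp only [conj_trivial]
    field_simp
    ring
  rw [h2]
  have h3 : affVal P a y * affVal P a x₀ < 0 := mul_neg_of_neg_of_pos hy hx₀
  have h4 : 0 < 4 / ⟪P.root a.1, P.root a.1⟫ := by positivity
  nlinarith

/-- Every orbit of the affine Weyl group meets the simplex. -/
theorem IsEuclidean.exists_mem_simplex (hP : IsEuclidean P) [Finite ι] [P.IsRootSystem]
    [P.IsCrystallographic] [P.IsReduced] {ξ : ι}
    (hξ : IsHighestRoot b ξ) (x : V) :
    ∃ w ∈ weylGroup b, ∃ q ∈ rootLattice b.flip, w x + q ∈ simplex b ξ := by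
  obtain ⟨x₀, hx₀⟩ := openSimplex_nonempty b hξ
  have hnorm : ∀ w ∈ weylGroup b, ‖w x‖ = ‖x‖ := fun w hw => by
    rw [@norm_eq_sqrt_real_inner, hP.inner_weylGroup b hw, ← norm_eq_sqrt_real_inner]
  -- Only finitely many images of x are as close to the interior point x₀ as x is, since W is finite
  -- and Q^∨ discrete. The nearest lies in the simplex, as reflecting in a violated wall would bring
  -- it closer.
  set T : Set ((V ≃ₗ[ℝ] V) × V) :=
    {p | (p.1 ∈ weylGroup b ∧ p.2 ∈ rootLattice b.flip) ∧ ‖p.1 x + p.2 - x₀‖ ≤ ‖x - x₀‖} with hT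
  have hfin : T.Finite := by
    have := finite_weylGroup b
    refine ((Set.toFinite (weylGroup b : Set (V ≃ₗ[ℝ] V))).prod
      (finite_rootLattice_inter b.flip (Metric.isBounded_closedBall (x := (0 : V))
        (r := ‖x - x₀‖ + ‖x₀‖ + ‖x‖)))).subset ?_
    rintro ⟨w, q⟩ ⟨⟨hw, hq⟩, h⟩
    refine ⟨hw, mem_closedBall_zero_iff.2 ?_, hq⟩
    simp only at h hw ⊢
    have h1 : q = (w x + q - x₀) + x₀ - w x := by abel
    calc ‖q‖ = ‖(w x + q - x₀) + x₀ - w x‖ := by rw [← h1]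
      _ ≤ ‖w x + q - x₀‖ + ‖x₀‖ + ‖w x‖ :=
        (norm_sub_le _ _).trans (add_le_add_left (norm_add_le _ _) _)
      _ ≤ _ := by rw [hnorm w hw]; gcongr
  have hne : T.Nonempty := ⟨(1, 0), ⟨one_mem _, zero_mem _⟩, by simp⟩
  obtain ⟨⟨w, q⟩, ⟨⟨hw, hq⟩, hle⟩, hmin⟩ :=
    Set.exists_min_image T (fun p => ‖p.1 x + p.2 - x₀‖) hfin hne
  refine ⟨w, hw, q, hq, (hP.mem_simplex_iff b).2 fun s hs => ?_⟩
  by_contra! hneg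
  have hlt := hP.dist_affRefl_lt ((hP.mem_openSimplex_iff b).1 hx₀ s hs) hneg
  have hs1 : P.reflection s.1 ∈ weylGroup b := by
    rcases hs with ⟨h, -⟩ | rfl
    · exact Subgroup.subset_closure ⟨_, h, rfl⟩
    · exact reflection_mem_weylGroup b _
  have heq : affRefl P s (w x + q)
      = (P.reflection s.1 * w) x + (P.reflection s.1 q - (s.2 : ℝ) • P.coroot s.1) := by
    rw [affRefl_apply, hP.affVal_eq, LinearEquiv.mul_apply, ← add_sub_assoc, ← map_add,
      hP.reflection_apply']
    module
  have hq' : P.reflection s.1 q - (s.2 : ℝ) • P.coroot s.1 ∈ rootLattice b.flip := by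
    refine sub_mem (hP.weylGroup_apply_mem_rootLattice_flip b hs1 hq) ?_
    rw [Int.cast_smul_eq_zsmul]
    exact zsmul_mem (root_mem_rootLattice b.flip s.1) _
  rw [heq] at hlt
  exact absurd (hmin (_, _) ⟨⟨mul_mem hs1 hw, hq'⟩, hlt.le.trans hle⟩) (not_le.2 hlt)

end Existence

/-! ### The even domain is a fundamental domain for W^e ⋉ Q^∨ -/

section EvenDomain

variable {V : Type*} [NormedAddCommGroup V] [InnerProductSpace ℝ V] {ι : Type*}
  {P : RootPairing ι ℝ V V} (b : P.Base) [Finite ι] [P.IsRootSystem] [P.IsCrystallographic]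
  [P.IsReduced]

/-- Every orbit of the even affine Weyl group meets the even domain. -/
theorem IsEuclidean.exists_mem_evenDomain (hP : IsEuclidean P) {ξ : ι} (hξ : IsHighestRoot b ξ)
    (j : b.support) (x : V) :
    ∃ w ∈ evenWeylGroup b, ∃ q ∈ rootLattice b.flip, w x + q ∈ evenDomain b ξ j := by
  have : FiniteDimensional ℝ V := Module.Finite.of_basis b.toWeightBasis
  obtain ⟨w, hw, q, hq, h⟩ := hP.exists_mem_simplex b hξ x
  rcases hP.det_weylGroup b hw with hd | hd
  · exact ⟨w, ⟨hw, hd⟩, q, hq, .inl h⟩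
  -- For odd w, an interior point is moved by r_j into the second half of the domain; a boundary
  -- point is fixed by the reflection in a wall through it, which makes w even.
  by_cases ho : w x + q ∈ openSimplex b ξ
  · have hj := reflection_mem_weylGroup b j
    refine ⟨P.reflection j * w, ⟨mul_mem hj hw, ?_⟩, P.reflection j q,
      hP.weylGroup_apply_mem_rootLattice_flip b hj hq, .inr ⟨_, ho, ?_⟩⟩
    · rw [map_mul, hd, hP.det_reflection]; simp
    · rw [map_add]; rfl
  · rw [hP.mem_openSimplex_iff] at ho
    push Not at ho
    obtain ⟨s, hs, h0⟩ := ho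
    have h1 := le_antisymm h0 ((hP.mem_simplex_iff b).1 h s hs)
    have hs1 := reflection_mem_weylGroup b s.1
    refine ⟨P.reflection s.1 * w, ⟨mul_mem hs1 hw, ?_⟩,
      P.reflection s.1 q - (s.2 : ℝ) • P.coroot s.1, ?_, .inl ?_⟩
    · rw [map_mul, hd, hP.det_reflection]; simp
    · refine sub_mem (hP.weylGroup_apply_mem_rootLattice_flip b hs1 hq) ?_
      rw [Int.cast_smul_eq_zsmul]
      exact zsmul_mem (root_mem_rootLattice b.flip s.1) _
    · convert! h using 1
      rw [LinearEquiv.mul_apply, ← add_sub_assoc, ← map_add, hP.reflection_apply']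
      rw [hP.affVal_eq] at h1
      rw [sub_sub, ← add_smul, h1, zero_smul, sub_zero]

/-- The even domain meets every orbit of the even affine Weyl group at most once. -/
theorem IsEuclidean.eq_of_mem_evenDomain (hP : IsEuclidean P) {ξ : ι} (hξ : IsHighestRoot b ξ)
    {j : b.support} {w : V ≃ₗ[ℝ] V} (hw : w ∈ evenWeylGroup b) {q : V}
    (hq : q ∈ rootLattice b.flip) {y : V} (hy : y ∈ evenDomain b ξ j)
    (hy' : w y + q ∈ evenDomain b ξ j) : w y + q = y := by
  have : FiniteDimensional ℝ V := Module.Finite.of_basis b.toWeightBasis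
  have hj := reflection_mem_weylGroup b j
  have hdet : ∀ u : V ≃ₗ[ℝ] V, u = 1 → LinearEquiv.det u ≠ -1 := by
    rintro u rfl h
    rw [map_one] at h
    have := congrArg Units.val h
    norm_num at this
  -- In the two mixed cases an odd element would send an interior point into the simplex, so it
  -- would be 1. If both points are reflected, conjugation by r_j reduces to the simplex.
  rcases hy with hy | ⟨z, hz, rfl⟩ <;> rcases hy' with hy' | ⟨z', hz', h⟩
  · exact hP.eq_of_mem_simplex b hξ hw.1 hq hy hy'
  · have h1 : z' = (P.reflection j * w) y + P.reflection j q := by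
      rw [LinearEquiv.mul_apply, ← map_add, ← h, P.reflection_same]
    have hz1 := openSimplex_subset b ξ hz'
    have h2 := hP.weylGroup_apply_mem_rootLattice_flip b hj hq
    have h3 := hP.eq_of_mem_simplex b hξ (mul_mem hj hw.1) h2 hy (by rwa [← h1])
    rw [← h1] at h3
    subst h3
    refine absurd ?_ (hdet _ (hP.eq_one_of_mem_openSimplex b hξ (mul_mem hj hw.1) h2 hz'
      (by rwa [← h1])))
    rw [map_mul, hw.2, hP.det_reflection, mul_one]
  · refine absurd ?_ (hdet _ (hP.eq_one_of_mem_openSimplex b hξ (mul_mem hw.1 hj) hq hz hy'))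
    rw [map_mul, hw.2, hP.det_reflection, one_mul]
  · have h1 : z' = (P.reflection j * w * P.reflection j) z + P.reflection j q := by
      rw [LinearEquiv.mul_apply, LinearEquiv.mul_apply, ← map_add, ← h, P.reflection_same]
    have h3 := hP.eq_of_mem_simplex b hξ (mul_mem (mul_mem hj hw.1) hj)
      (hP.weylGroup_apply_mem_rootLattice_flip b hj hq) (openSimplex_subset b ξ hz)
      (by rw [← h1]; exact openSimplex_subset b ξ hz')
    rw [← h, h1, h3]

end EvenDomain

/-! ### The exponential t ↦ exp(2πit) -/

section ExpI

/-- `t ↦ exp(2πit)`. -/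
def expI (t : ℝ) : ℂ := Complex.exp (2 * Real.pi * Complex.I * (t : ℂ))

theorem expI_add (s t : ℝ) : expI (s + t) = expI s * expI t := by
  rw [expI, expI, expI, ← Complex.exp_add]
  push_cast
  ring_nf

@[simp]
theorem expI_zero : expI 0 = 1 := by simp [expI]

theorem expI_eq_one_iff {t : ℝ} : expI t = 1 ↔ ∃ k : ℤ, t = k := by
  rw [expI, Complex.exp_eq_one_iff]
  refine exists_congr fun k => ?_
  rw [mul_comm, mul_left_inj' (by simp [Real.pi_ne_zero])]
  norm_cast

theorem expI_add_of_int {s t : ℝ} (h : ∃ k : ℤ, t = k) : expI (s + t) = expI s := by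
  rw [expI_add, expI_eq_one_iff.2 h, mul_one]

theorem conj_expI (t : ℝ) : (starRingEnd ℂ) (expI t) = expI (-t) := by
  rw [expI, expI, ← Complex.exp_conj]
  simp [Complex.conj_ofNat]

theorem expI_neg (t : ℝ) : expI (-t) = (expI t)⁻¹ := by
  refine (inv_eq_of_mul_eq_one_left ?_).symm
  rw [← expI_add, neg_add_cancel, expI_zero]

theorem exists_expI_eq {z : ℂ} (hz : ‖z‖ = 1) : ∃ t, expI t = z := by
  obtain ⟨θ, hθ⟩ := (Complex.norm_eq_one_iff z).1 hz
  refine ⟨θ / (2 * Real.pi), ?_⟩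
  rw [← hθ, expI]
  congr 1
  push_cast
  field_simp

end ExpI

/-! ### The group (1/M)P^∨/Q^∨: order and characters -/

section Lattices

variable {V : Type*} [NormedAddCommGroup V] [InnerProductSpace ℝ V] {ι : Type*}
  {P : RootPairing ι ℝ V V} (b : P.Base)

/-- The lattice `(1/M) P^∨`. -/
def refinedLattice (M : ℕ) : AddSubgroup V where
  carrier := {a | (M : ℝ) • a ∈ dualWeightLattice b}
  add_mem' {x y} hx hy i hi := by
    obtain ⟨k, hk⟩ := hx i hi
    obtain ⟨l, hl⟩ := hy i hi
    exact ⟨k + l, by rw [smul_add, inner_add_left, hk, hl, Int.cast_add]⟩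
  zero_mem' i _ := ⟨0, by simp⟩
  neg_mem' {x} hx i hi := by
    obtain ⟨k, hk⟩ := hx i hi
    exact ⟨-k, by rw [smul_neg, inner_neg_left, hk, Int.cast_neg]⟩

theorem mem_refinedLattice {M : ℕ} {x : V} :
    x ∈ refinedLattice b M ↔ (M : ℝ) • x ∈ dualWeightLattice b := Iff.rfl

variable {b} in
theorem inner_int_of_mem {x y : V} (hx : x ∈ dualWeightLattice b) (hy : y ∈ rootLattice b) :
    ∃ k : ℤ, ⟪x, y⟫ = k := by
  induction hy using AddSubgroup.closure_induction with
  | mem y hy => obtain ⟨i, hi, rfl⟩ := hy; exact hx i hi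
  | zero => exact ⟨0, by simp⟩
  | add y z _ _ hy hz =>
    obtain ⟨k, hk⟩ := hy
    obtain ⟨l, hl⟩ := hz
    exact ⟨k + l, by rw [inner_add_right, hk, hl, Int.cast_add]⟩
  | neg y _ hy =>
    obtain ⟨k, hk⟩ := hy
    exact ⟨-k, by rw [inner_neg_right, hk, Int.cast_neg]⟩

theorem IsEuclidean.rootLattice_flip_le (hP : IsEuclidean P) [P.IsCrystallographic] (M : ℕ) :
    rootLattice b.flip ≤ refinedLattice b M := by
  refine (AddSubgroup.closure_le _).2 ?_
  rintro _ ⟨k, -, rfl⟩ i hi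
  refine ⟨M * P.pairingIn ℤ i k, ?_⟩
  have : (P.pairingIn ℤ i k : ℝ) = P.pairing i k := P.algebraMap_pairingIn ℤ _ _
  rw [inner_smul_left, RootPairing.flip_root, hP.inner_coroot_root]
  push_cast
  rw [this]
  simp

theorem IsEuclidean.apply_mem_dualWeightLattice (hP : IsEuclidean P) {w : V ≃ₗ[ℝ] V}
    (hw : w ∈ weylGroup b) {x : V} (hx : x ∈ dualWeightLattice b) : w x ∈ dualWeightLattice b := by
  intro i hi
  rw [hP.inner_weylGroup_left b hw]
  exact inner_int_of_mem hx
    (weylGroup_apply_mem_rootLattice b (inv_mem hw) (AddSubgroup.subset_closure ⟨i, hi, rfl⟩))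

theorem IsEuclidean.apply_mem_refinedLattice (hP : IsEuclidean P) {w : V ≃ₗ[ℝ] V}
    (hw : w ∈ weylGroup b) {M : ℕ} {x : V} (hx : x ∈ refinedLattice b M) :
    w x ∈ refinedLattice b M := by
  rw [mem_refinedLattice, ← map_smul]
  exact hP.apply_mem_dualWeightLattice b hw hx

theorem add_mem_dualWeightLattice {x y : V} (hx : x ∈ dualWeightLattice b)
    (hy : y ∈ dualWeightLattice b) : x + y ∈ dualWeightLattice b := by
  have := add_mem (show x ∈ refinedLattice b 1 by simpa [mem_refinedLattice])
    (show y ∈ refinedLattice b 1 by simpa [mem_refinedLattice])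
  simpa [mem_refinedLattice] using this

theorem sub_mem_dualWeightLattice {x y : V} (hx : x ∈ dualWeightLattice b)
    (hy : y ∈ dualWeightLattice b) : x - y ∈ dualWeightLattice b := by
  have := sub_mem (show x ∈ refinedLattice b 1 by simpa [mem_refinedLattice])
    (show y ∈ refinedLattice b 1 by simpa [mem_refinedLattice])
  simpa [mem_refinedLattice] using this

variable [P.IsRootSystem]

section CoweightBasis

variable [DecidableEq ι] {ω : Module.Basis b.support ℝ V}
  (hω : ∀ i j : b.support, ⟪ω i, P.root j⟫ = if i = j then 1 else 0)
include hω

omit [P.IsRootSystem] in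
theorem coweight_repr (x : V) (i : b.support) : ω.repr x i = ⟪x, P.root i⟫ := by
  conv_rhs => rw [← ω.sum_repr x]
  simp [sum_inner, inner_smul_left, hω]

theorem sum_inner_coweight (x : V) : ∑ i, ⟪x, ω i⟫ • P.root i = x := by
  have h : ∀ i, ⟪x, ω i⟫ = b.toWeightBasis.repr x i := fun i => by
    conv_lhs => rw [real_inner_comm, ← b.toWeightBasis.sum_repr x]
    simp [inner_sum, inner_smul_right, hω, -Finset.univ_eq_attach]
  conv_rhs => rw [← b.toWeightBasis.sum_repr x]
  simp [h]

omit [P.IsRootSystem] in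
theorem refinedLattice_eq_closure {M : ℕ} (hM : 0 < M) :
    refinedLattice b M = AddSubgroup.closure (Set.range fun i => (M : ℝ)⁻¹ • ω i) := by
  have hM' : (M : ℝ) ≠ 0 := by positivity
  refine le_antisymm (fun x hx => ?_) ((AddSubgroup.closure_le _).2 ?_)
  · choose k hk using fun i : b.support => hx i i.2
    have : x = ∑ i, k i • ((M : ℝ)⁻¹ • ω i) := by
      conv_lhs => rw [← inv_smul_smul₀ hM' x, ← ω.sum_repr ((M : ℝ) • x), Finset.smul_sum]
      refine Finset.sum_congr rfl fun i _ => ?_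
      rw [coweight_repr b hω, hk, Int.cast_smul_eq_zsmul, smul_comm]
    rw [this]
    exact sum_mem fun i _ => zsmul_mem (AddSubgroup.subset_closure (Set.mem_range_self i)) _
  · rintro _ ⟨k, rfl⟩ i hi
    use if k = ⟨i, hi⟩ then 1 else 0
    simp only [smul_inv_smul₀ hM', hω k ⟨i, hi⟩]
    split_ifs <;> simp

end CoweightBasis

omit [P.IsRootSystem] in
-- The Cartan matrix is the positive definite Gram matrix times a positive diagonal matrix.
theorem IsEuclidean.centerOrder_pos (hP : IsEuclidean P) [P.IsCrystallographic] :
    0 < centerOrder b := by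
  classical
  have hG := (Matrix.posDef_gram_of_linearIndependent (𝕜 := ℝ) (v := fun i : b.support => P.root i)
    b.linearIndepOn_root).det_pos
  have h : b.cartanMatrix.map (Int.cast : ℤ → ℝ)
      = Matrix.gram ℝ (fun i : b.support => P.root i) *
        Matrix.diagonal fun i : b.support => 2 / ⟪P.root i, P.root i⟫ := by
    ext i j
    have : (b.cartanMatrix i j : ℝ) = P.pairing i j := P.algebraMap_pairingIn ℤ _ _
    rw [Matrix.mul_diagonal, Matrix.map_apply, Matrix.gram_apply, this, ← hP.inner_root_coroot, hP.coroot_eq, inner_smul_right, mul_comm]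
  have h2 : (0 : ℝ) < ((b.cartanMatrix.det : ℤ) : ℝ) := by
    rw [Int.cast_det, h, Matrix.det_mul, Matrix.det_diagonal]
    refine mul_pos hG (Finset.prod_pos fun i _ => ?_)
    have := inner_root_self_pos P i
    positivity
  have h3 : 0 < b.cartanMatrix.det := by exact_mod_cast h2
  unfold centerOrder
  convert h3

/-- The finite group `(1/M) P^∨ / Q^∨`, as a subgroup of the torus `V / Q^∨`. -/
def torusGrid (M : ℕ) : AddSubgroup (V ⧸ rootLattice b.flip) :=
  (refinedLattice b M).map (QuotientAddGroup.mk' (rootLattice b.flip))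

/-- The order is a lattice index: in the basis ω_i/M of (1/M)P^∨ the simple coroots have coordinate
matrix M times the Cartan matrix. -/
theorem IsEuclidean.card_torusGrid (hP : IsEuclidean P) [P.IsCrystallographic] {M : ℕ}
    (hM : 0 < M) :
    (Nat.card (torusGrid b M) : ℤ) = centerOrder b * (M : ℤ) ^ b.support.card := by
  classical
  have hM' : (M : ℝ) ≠ 0 := by positivity
  obtain ⟨ω, hω⟩ := exists_coweight_basis b
  have h1 : Nat.card (torusGrid b M) = (rootLattice b.flip).relIndex (refinedLattice b M) := by
    rw [torusGrid, ← AddSubgroup.relIndex_ker, QuotientAddGroup.ker_mk']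
  let ω' := ω.isUnitSMul (w := fun _ => (M : ℝ)⁻¹) fun _ => (IsUnit.mk0 _ (inv_ne_zero hM'))
  have hω' : ∀ i, ω' i = (M : ℝ)⁻¹ • ω i := fun i => Module.Basis.isUnitSMul_apply _ _
  have h2 : refinedLattice b M = AddSubgroup.closure (Set.range ω') := by
    rw [refinedLattice_eq_closure b hω hM]
    congr 2
    ext i
    rw [hω']
  have h3 : rootLattice b.flip = AddSubgroup.closure (Set.range b.toCoweightBasis) := by
    rw [rootLattice]
    congr 1
    ext x
    simp
  have hrepr : ∀ x i, ω'.repr x i = M * ⟪x, P.root i⟫ := by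
    intro x i
    conv_rhs => rw [← ω'.sum_repr x]
    simp [sum_inner, inner_smul_left, hω', hω, hM', mul_comm]
  rw [h1, AddSubgroup.relIndex_eq_natAbs_det _ _ (hP.rootLattice_flip_le b M)
    (b.toCoweightBasis.addSubgroupOfClosure _ h3) (ω'.addSubgroupOfClosure _ h2)]
  have h5 : (ω'.addSubgroupOfClosure _ h2).toMatrix (fun i =>
      ⟨b.toCoweightBasis.addSubgroupOfClosure _ h3 i,
        (hP.rootLattice_flip_le b M) (SetLike.coe_mem _)⟩) = (M : ℤ) • b.cartanMatrix := by
    ext i k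
    have : (b.cartanMatrix i k : ℝ) = P.pairing i k := P.algebraMap_pairingIn ℤ _ _
    have h6 : ∀ a c : ℤ, (a : ℝ) = c → a = c := fun a c h => by exact_mod_cast h
    apply h6
    rw [Module.Basis.toMatrix_apply]
    refine (Module.Basis.addSubgroupOfClosure_repr_apply _ _ _ _ _).trans ?_
    rw [hrepr]
    simp [this, hP.inner_coroot_root]
  have h7 : b.cartanMatrix.det = centerOrder b := by
    unfold centerOrder
    congr!
  rw [Module.Basis.det_apply, h5, Matrix.det_smul, Fintype.card_coe, h7, Int.natAbs_of_nonneg,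
    mul_comm]
  have := hP.centerOrder_pos b
  positivity

/-- The characters of the finite group `(1/M) P^∨ / Q^∨` are given by the weights. -/
theorem IsEuclidean.exists_weight_of_addChar (hP : IsEuclidean P) [P.IsCrystallographic] {M : ℕ}
    (hM : 0 < M) [Finite (torusGrid b M)] (ψ : AddChar (torusGrid b M) ℂ) :
    ∃ l ∈ dualWeightLattice b.flip, ∀ x (hx : x ∈ refinedLattice b M),
      ψ ⟨QuotientAddGroup.mk' _ x, AddSubgroup.mem_map_of_mem _ hx⟩ = expI ⟪l, x⟫ := by
  classical
  have hM' : (M : ℝ) ≠ 0 := by positivity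
  obtain ⟨ω, hω⟩ := exists_coweight_basis b
  have hcl := refinedLattice_eq_closure b hω hM
  have hmem : ∀ i, (M : ℝ)⁻¹ • ω i ∈ refinedLattice b M := fun i => by
    rw [hcl]
    exact AddSubgroup.subset_closure ⟨i, rfl⟩
  choose θ hθ using fun i => exists_expI_eq (AddChar.norm_apply ψ
    ⟨QuotientAddGroup.mk' _ _, AddSubgroup.mem_map_of_mem _ (hmem i)⟩)
  -- The simple roots are dual to the ω_i, so this l has the prescribed phases θ_i on the generators
  -- ω_i/M.
  set l : V := (M : ℝ) • ∑ i, θ i • P.root i with hl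
  have hlω : ∀ k, ⟪l, (M : ℝ)⁻¹ • ω k⟫ = θ k := fun k => by
    rw [real_inner_comm]
    simp [hl, inner_sum, inner_smul_left, inner_smul_right, hω, -Finset.univ_eq_attach]
    field_simp
  have key : ∀ x (hx : x ∈ refinedLattice b M),
      ψ ⟨QuotientAddGroup.mk' _ x, AddSubgroup.mem_map_of_mem _ hx⟩ = expI ⟪l, x⟫ := by
    suffices h : ∀ x (_ : x ∈ AddSubgroup.closure (Set.range fun i => (M : ℝ)⁻¹ • ω i)),
        ∀ hx : x ∈ refinedLattice b M,
        ψ ⟨QuotientAddGroup.mk' _ x, AddSubgroup.mem_map_of_mem _ hx⟩ = expI ⟪l, x⟫ from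
      fun x hx => h x (hcl ▸ hx) hx
    intro x hx
    induction hx using AddSubgroup.closure_induction with
    | mem x hx =>
      obtain ⟨i, rfl⟩ := hx
      intro _
      simp only [hlω]
      exact (hθ i).symm
    | zero =>
      intro _
      rw [inner_zero_right, expI_zero, ← ψ.map_zero_eq_one]
      rfl
    | add x y hx hy ihx ihy =>
      intro _
      rw [inner_add_right, expI_add, ← ihx (hcl ▸ hx), ← ihy (hcl ▸ hy), ← ψ.map_add_eq_mul]
      rfl
    | neg x hx ih =>
      intro _
      rw [inner_neg_right, expI_neg, ← ih (hcl ▸ hx), ← ψ.map_neg_eq_inv]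
      rfl
  -- Coroots vanish in the quotient, so the character is 1 on them, and l pairs integrally with
  -- them.
  refine ⟨l, fun i hi => ?_, key⟩
  have hq : P.coroot i ∈ rootLattice b.flip := root_mem_rootLattice b.flip i
  have h := key _ (hP.rootLattice_flip_le b M hq)
  have h0 : (QuotientAddGroup.mk' (rootLattice b.flip) (P.coroot i)) = 0 :=
    (QuotientAddGroup.eq_zero_iff _).2 hq
  simp only [h0] at h
  rw [RootPairing.flip_root, ← expI_eq_one_iff, ← h]
  exact ψ.map_zero_eq_one

/-- A weight pairing integrally with `(1/M) P^∨` lies in `M Q`. -/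
theorem exists_rootLattice_of_inner_int {M : ℕ} (hM : 0 < M) {l : V}
    (hl : ∀ x ∈ refinedLattice b M, ∃ k : ℤ, ⟪l, x⟫ = k) :
    ∃ q ∈ rootLattice b, l = (M : ℝ) • q := by
  classical
  have hM' : (M : ℝ) ≠ 0 := by positivity
  obtain ⟨ω, hω⟩ := exists_coweight_basis b
  have hcl := refinedLattice_eq_closure b hω hM
  choose k hk using fun i => hl ((M : ℝ)⁻¹ • ω i) (by
    rw [hcl]
    exact AddSubgroup.subset_closure ⟨i, rfl⟩)
  refine ⟨∑ i, k i • P.root i, sum_mem fun i _ => zsmul_mem (root_mem_rootLattice b i) _, ?_⟩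
  rw [← sum_inner_coweight b hω l, Finset.smul_sum]
  refine Finset.sum_congr rfl fun i _ => ?_
  rw [← Int.cast_smul_eq_zsmul ℝ, ← hk, inner_smul_right, smul_smul, mul_inv_cancel_left₀ hM']

end Lattices

/-! ### The point grid as the set of W^e-orbits on the finite group -/

section Grids

variable {V : Type*} [NormedAddCommGroup V] [InnerProductSpace ℝ V] {ι : Type*} [Finite ι]
  {P : RootPairing ι ℝ V V} (b : P.Base) [P.IsRootSystem] [P.IsCrystallographic]
  [P.IsReduced] (hP : IsEuclidean P) {ξ η : ι} (j : b.support) (j' : b.flip.support) {M : ℕ}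
  (hM : 0 < M)

include hP

/-- The retraction of `V` onto the even domain along the orbits of the even affine Weyl group. -/
theorem IsEuclidean.exists_retraction (hξ : IsHighestRoot b ξ) :
    ∃ r : V → V, (∀ x, r x ∈ evenDomain b ξ j ∧
        ∃ w ∈ evenWeylGroup b, ∃ q ∈ rootLattice b.flip, r x = w x + q) ∧
      ∀ w ∈ evenWeylGroup b, ∀ q ∈ rootLattice b.flip, ∀ x ∈ evenDomain b ξ j,
        r (w x + q) = x := by
  choose w hw q hq h using hP.exists_mem_evenDomain b hξ j
  refine ⟨fun x => w x x + q x, fun x => ⟨h x, w x, hw x, q x, hq x, rfl⟩, ?_⟩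
  intro u hu p hp x hx
  have h1 := h (u x + p)
  have h2 : w (u x + p) (u x + p) + q (u x + p)
      = (w (u x + p) * u) x + (w (u x + p) p + q (u x + p)) := by
    rw [map_add, LinearEquiv.mul_apply, add_assoc]
  simp only [h2] at h1 ⊢
  exact hP.eq_of_mem_evenDomain b hξ (mul_mem (hw _) hu)
    (add_mem (hP.weylGroup_apply_mem_rootLattice_flip b (hw _).1 hp) (hq _)) hx h1

omit [P.IsReduced] hP [Finite ι] [P.IsRootSystem] [P.IsCrystallographic] in
theorem exists_out_mk (x : V) :
    ∃ q ∈ rootLattice b.flip, (x : V ⧸ rootLattice b.flip).out = x + q := by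
  refine ⟨-x + (x : V ⧸ rootLattice b.flip).out, ?_, by abel⟩
  rw [← QuotientAddGroup.eq, QuotientAddGroup.out_eq']

omit [P.IsReduced] [Finite ι] [P.IsRootSystem] in
theorem IsEuclidean.out_mem_refinedLattice (a : torusGrid b M) :
    (a : V ⧸ rootLattice b.flip).out ∈ refinedLattice b M := by
  obtain ⟨_, y, hy, rfl⟩ := a
  obtain ⟨q, hq, h⟩ := exists_out_mk b y
  refine (congrArg (· ∈ refinedLattice b M) h).mpr ?_
  exact add_mem hy (hP.rootLattice_flip_le b M hq)

include hM

omit [P.IsReduced] [Finite ι] in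
theorem IsEuclidean.finite_torusGrid : Finite (torusGrid b M) := by
  refine Nat.finite_of_card_ne_zero fun h => ?_
  have h1 := hP.card_torusGrid b hM
  have := hP.centerOrder_pos b
  rw [h] at h1
  have : 0 < centerOrder b * (M : ℤ) ^ b.support.card := by positivity
  lia

/-- Each grid point is recovered by the retraction from its class in the finite group. -/
theorem IsEuclidean.finite_pointGrid (hξ : IsHighestRoot b ξ) : (pointGrid b ξ j M).Finite := by
  have := hP.finite_torusGrid b hM
  obtain ⟨r, -, hr⟩ := hP.exists_retraction b j hξ
  refine (Set.finite_range fun a : torusGrid b M => r (a : V ⧸ rootLattice b.flip).out).subset ?_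
  rintro x ⟨hx, hx'⟩
  obtain ⟨q, hq, h⟩ := exists_out_mk b x
  refine ⟨⟨QuotientAddGroup.mk' _ x, AddSubgroup.mem_map_of_mem _ hx⟩, ?_⟩
  have : r (x + q) = x := hr 1 (one_mem _) q hq x hx'
  rw [← h] at this
  exact this

/-- Sums over `(1/M) P^∨ / Q^∨` of invariant functions, as weighted sums over the grid. -/
theorem IsEuclidean.sum_torusGrid (hξ : IsHighestRoot b ξ) [Fintype (torusGrid b M)] {h : V → ℂ}
    (hq : ∀ x ∈ refinedLattice b M, ∀ q ∈ rootLattice b.flip, h (x + q) = h x)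
    (hw : ∀ x, ∀ w ∈ evenWeylGroup b, h (w x) = h x) :
    ∑ a : torusGrid b M, h (a : V ⧸ rootLattice b.flip).out
      = ∑ᶠ x : pointGrid b ξ j M, (orbitSize b (x : V) : ℂ) * h x := by
  classical
  have := (hP.finite_pointGrid b j hM hξ).fintype
  obtain ⟨r, hr, hr'⟩ := hP.exists_retraction b j hξ
  have hrmem : ∀ a : torusGrid b M, r (a : V ⧸ rootLattice b.flip).out ∈ pointGrid b ξ j M := by
    intro a
    obtain ⟨h1, w, hw, q, hq, h2⟩ := hr (a : V ⧸ rootLattice b.flip).out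
    refine ⟨?_, h1⟩
    rw [← mem_refinedLattice, h2]
    exact add_mem (hP.apply_mem_refinedLattice b hw.1 (hP.out_mem_refinedLattice b a))
      (hP.rootLattice_flip_le b M hq)
  let rep : torusGrid b M → pointGrid b ξ j M := fun a => ⟨_, hrmem a⟩
  rw [finsum_eq_sum_of_fintype, ← Finset.sum_fiberwise Finset.univ rep]
  refine Finset.sum_congr rfl fun x _ => ?_
  have hconst : ∀ a ∈ Finset.univ.filter (fun a => rep a = x),
      h (a : V ⧸ rootLattice b.flip).out = h x := by
    intro a ha
    rw [← (Finset.mem_filter.1 ha).2]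
    obtain ⟨-, w, hw1, q, hq1, h2⟩ := hr (a : V ⧸ rootLattice b.flip).out
    change _ = h (r _)
    rw [h2, hq _ (hP.apply_mem_refinedLattice b hw1.1 (hP.out_mem_refinedLattice b a)) _ hq1,
      hw _ _ hw1]
  rw [Finset.sum_congr rfl hconst, Finset.sum_const, nsmul_eq_mul]
  congr 2
  -- What remains is that the fibre of `rep` over x is the W^e-orbit of x + Q^∨.
  rw [orbitSize, ← Finset.card_map (Function.Embedding.subtype _), ← Set.ncard_coe_finset]
  congr 1
  ext t
  simp only [Finset.coe_map, Finset.coe_filter, Finset.mem_univ, true_and, Set.mem_image,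
    Set.mem_ofPred_eq, Set.mem_range, Function.Embedding.subtype_apply]
  constructor
  · rintro ⟨a, ha, rfl⟩
    obtain ⟨-, w, hw1, q, hq1, h2⟩ := hr (a : V ⧸ rootLattice b.flip).out
    refine ⟨⟨w⁻¹, inv_mem hw1⟩, ?_⟩
    rw [← ha]
    change QuotientAddGroup.mk (w⁻¹ (r _)) = _
    conv_rhs => rw [← QuotientAddGroup.out_eq' (a : V ⧸ rootLattice b.flip)]
    have hinv : ∀ y, w⁻¹ (w y) = y := w.symm_apply_apply
    rw [h2, map_add, hinv, eq_comm, QuotientAddGroup.eq, neg_add_cancel_left]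
    exact hP.weylGroup_apply_mem_rootLattice_flip b (inv_mem hw1).1 hq1
  · rintro ⟨w, rfl⟩
    have hwx := hP.apply_mem_refinedLattice b w.2.1 (mem_refinedLattice b |>.2 x.2.1)
    refine ⟨⟨QuotientAddGroup.mk' _ _, AddSubgroup.mem_map_of_mem _ hwx⟩, Subtype.ext ?_, rfl⟩
    obtain ⟨q, hq1, h2⟩ := exists_out_mk b ((w : V ≃ₗ[ℝ] V) x)
    have := hr' w w.2 q hq1 x x.2.2
    rw [← h2] at this
    exact this

omit [P.IsReduced] [Finite ι] in
open Classical in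
-- A character that is nontrivial at some x has sum zero: translating by x multiplies the sum by a
-- factor other than 1. The character of l is trivial exactly when l lies in MQ.
theorem IsEuclidean.sum_expI [Fintype (torusGrid b M)] {l : V}
    (hl : l ∈ dualWeightLattice b.flip) :
    ∑ a : torusGrid b M, expI ⟪l, (a : V ⧸ rootLattice b.flip).out⟫
      = if ∃ q ∈ rootLattice b, l = (M : ℝ) • q then (Fintype.card (torusGrid b M) : ℂ) else 0 := by
  split_ifs with h
  · obtain ⟨q, hq, rfl⟩ := h
    have : ∀ a : torusGrid b M, expI ⟪(M : ℝ) • q, (a : V ⧸ rootLattice b.flip).out⟫ = 1 := by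
      intro a
      obtain ⟨k, hk⟩ := inner_int_of_mem (hP.out_mem_refinedLattice b a) hq
      rw [expI_eq_one_iff]
      refine ⟨k, ?_⟩
      rw [← hk, real_inner_comm, inner_smul_left, inner_smul_right]
      simp
    simp [this]
  · have : ∃ x ∈ refinedLattice b M, expI ⟪l, x⟫ ≠ 1 := by
      by_contra! h1
      exact h (exists_rootLattice_of_inner_int b hM fun x hx => expI_eq_one_iff.1 (h1 x hx))
    obtain ⟨x, hx, hx1⟩ := this
    set a₀ : torusGrid b M := ⟨QuotientAddGroup.mk' _ x, AddSubgroup.mem_map_of_mem _ hx⟩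
    have h1 : ∀ a : torusGrid b M, expI ⟪l, ((a + a₀ : torusGrid b M) : V ⧸ rootLattice b.flip).out⟫
        = expI ⟪l, (a : V ⧸ rootLattice b.flip).out⟫ * expI ⟪l, x⟫ := by
      intro a
      have h2 : ((a + a₀ : torusGrid b M) : V ⧸ rootLattice b.flip)
          = (((a : V ⧸ rootLattice b.flip).out + x : V) : V ⧸ rootLattice b.flip) := by
        rw [QuotientAddGroup.mk_add, QuotientAddGroup.out_eq']
        rfl
      obtain ⟨q, hq, h3⟩ := exists_out_mk b ((a : V ⧸ rootLattice b.flip).out + x)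
      rw [h2, h3, inner_add_right, expI_add_of_int (inner_int_of_mem hl hq), inner_add_right,
        expI_add]
    have h2 := Equiv.sum_comp (Equiv.addRight a₀)
      fun a : torusGrid b M => expI ⟪l, (a : V ⧸ rootLattice b.flip).out⟫
    simp only [Equiv.coe_addRight, h1, ← Finset.sum_mul] at h2
    by_contra h3
    exact hx1 (mul_left_cancel₀ h3 (h2.trans (mul_one _).symm))

end Grids

/-! ### The weight grid as the set of W^e-orbits on P/MQ -/

section WeightGrid

variable {V : Type*} [NormedAddCommGroup V] [InnerProductSpace ℝ V] {ι : Type*} [Finite ι]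
  {P : RootPairing ι ℝ V V} (b : P.Base) [P.IsRootSystem] [P.IsCrystallographic]
  [P.IsReduced] (hP : IsEuclidean P) {η : ι} (hη : IsHighestRoot b.flip η) (j' : b.flip.support)
  {M : ℕ} (hM : 0 < M)

include hP hη hM

/-- Λ^e_M is M times the point grid of the dual root system, so the results for `b.flip` apply. -/
theorem IsEuclidean.finite_weightGrid : (weightGrid b η j' M).Finite := by
  refine ((hP.flip.finite_pointGrid b.flip j' hM hη).image fun a => (M : ℝ) • a).subset ?_
  rintro l ⟨hl, a, ha, rfl⟩
  exact ⟨a, ⟨hl, ha⟩, rfl⟩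

theorem IsEuclidean.exists_mem_weightGrid {l : V} (hl : l ∈ dualWeightLattice b.flip) :
    ∃ l' ∈ weightGrid b η j' M, ∃ w ∈ evenWeylGroup b, ∃ q ∈ rootLattice b,
      l' = w l + (M : ℝ) • q := by
  have hM' : (M : ℝ) ≠ 0 := by positivity
  obtain ⟨w, hw, q, hq, h⟩ := hP.flip.exists_mem_evenDomain b.flip hη j' ((M : ℝ)⁻¹ • l)
  have h1 : w l + (M : ℝ) • q = (M : ℝ) • (w ((M : ℝ)⁻¹ • l) + q) := by
    rw [smul_add, map_smul, smul_inv_smul₀ hM']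
  refine ⟨w l + (M : ℝ) • q, ⟨?_, _, h, h1⟩, w, ?_, q, hq, rfl⟩
  · exact add_mem_dualWeightLattice b.flip (hP.flip.apply_mem_dualWeightLattice b.flip hw.1 hl)
      (hP.flip.rootLattice_flip_le b.flip M hq)
  · rwa [hP.evenWeylGroup_flip] at hw

theorem IsEuclidean.eq_of_mem_weightGrid {l l' : V} (hl : l ∈ weightGrid b η j' M)
    (hl' : l' ∈ weightGrid b η j' M) {w : V ≃ₗ[ℝ] V} (hw : w ∈ evenWeylGroup b) {q : V}
    (hq : q ∈ rootLattice b) (h : l' = w l + (M : ℝ) • q) : l' = l := by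
  have hM' : (M : ℝ) ≠ 0 := by positivity
  obtain ⟨-, a, ha, rfl⟩ := hl
  obtain ⟨-, a', ha', rfl⟩ := hl'
  rw [map_smul, ← smul_add] at h
  have h1 := smul_right_injective V hM' h
  rw [← hP.evenWeylGroup_flip] at hw
  rw [h1, hP.flip.eq_of_mem_evenDomain b.flip hη hw hq ha (by rwa [← h1])]

end WeightGrid

/-! ### Invariance and periodicity of E-functions -/

section EFun

variable {V : Type*} [NormedAddCommGroup V] [InnerProductSpace ℝ V] {ι : Type*} [Finite ι]
  {P : RootPairing ι ℝ V V} (b : P.Base) [P.IsRootSystem]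

theorem eFun_eq (l x : V) : eFun b l x = ∑ w : evenWeylGroup b, expI ⟪(w : V ≃ₗ[ℝ] V) l, x⟫ := rfl

theorem eFun_apply_left (l x : V) {w : V ≃ₗ[ℝ] V} (hw : w ∈ evenWeylGroup b) :
    eFun b (w l) x = eFun b l x :=
  Equiv.sum_comp (Equiv.mulRight (⟨w, hw⟩ : evenWeylGroup b))
    fun u : evenWeylGroup b => expI ⟪(u : V ≃ₗ[ℝ] V) l, x⟫

theorem IsEuclidean.eFun_eq' (hP : IsEuclidean P) (l x : V) :
    eFun b l x = ∑ w : evenWeylGroup b, expI ⟪l, (w : V ≃ₗ[ℝ] V) x⟫ := by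
  rw [eFun_eq, ← Equiv.sum_comp (Equiv.inv (evenWeylGroup b))]
  refine Finset.sum_congr rfl fun w _ => ?_
  rw [hP.inner_weylGroup_left b ((Equiv.inv (evenWeylGroup b)) w).2.1]
  simp

theorem IsEuclidean.eFun_apply_right (hP : IsEuclidean P) (l x : V) {w : V ≃ₗ[ℝ] V}
    (hw : w ∈ evenWeylGroup b) : eFun b l (w x) = eFun b l x := by
  rw [hP.eFun_eq', hP.eFun_eq']
  exact Equiv.sum_comp (Equiv.mulRight (⟨w, hw⟩ : evenWeylGroup b))
    fun u : evenWeylGroup b => expI ⟪l, (u : V ≃ₗ[ℝ] V) x⟫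

theorem IsEuclidean.eFun_add_right (hP : IsEuclidean P) {l : V}
    (hl : l ∈ dualWeightLattice b.flip) (x : V) {q : V} (hq : q ∈ rootLattice b.flip) :
    eFun b l (x + q) = eFun b l x := by
  rw [hP.eFun_eq', hP.eFun_eq']
  refine Finset.sum_congr rfl fun w _ => ?_
  rw [map_add, inner_add_right, expI_add_of_int]
  exact inner_int_of_mem hl (hP.weylGroup_apply_mem_rootLattice_flip b w.2.1 hq)

theorem eFun_add_left {M : ℕ} (l : V) {x : V} (hx : x ∈ refinedLattice b M) {q : V}
    (hq : q ∈ rootLattice b) : eFun b (l + (M : ℝ) • q) x = eFun b l x := by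
  refine Finset.sum_congr rfl fun w _ => ?_
  have h : ⟪(w : V ≃ₗ[ℝ] V) (l + (M : ℝ) • q), x⟫
      = ⟪(w : V ≃ₗ[ℝ] V) l, x⟫ + ⟪(M : ℝ) • x, (w : V ≃ₗ[ℝ] V) q⟫ := by
    rw [map_add, map_smul, inner_add_left, inner_smul_left, inner_smul_left,
      real_inner_comm x ((w : V ≃ₗ[ℝ] V) q)]
  change expI _ = expI _
  rw [h, expI_add_of_int (inner_int_of_mem hx (weylGroup_apply_mem_rootLattice b w.2.1 hq))]

end EFun

/-! ### Discrete orthogonality and existence of the interpolant -/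

section Orthogonality

variable {V : Type*} [NormedAddCommGroup V] [InnerProductSpace ℝ V] {ι : Type*} [Finite ι]
  {P : RootPairing ι ℝ V V} (b : P.Base) [P.IsRootSystem] [P.IsCrystallographic]
  [P.IsReduced] (hP : IsEuclidean P) {ξ η : ι} (hξ : IsHighestRoot b ξ)
  (hη : IsHighestRoot b.flip η) (j : b.support) (j' : b.flip.support) {M : ℕ} (hM : 0 < M)

include hP hξ hη hM

open Classical in
omit hη in
-- The product of E-functions is invariant, so the grid sum is a sum over the finite group; each
-- pair (w, w') contributes the character sum of the weight wl - w'l'.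
theorem IsEuclidean.gridInner_eFun {l l' : V} (hl : l ∈ dualWeightLattice b.flip)
    (hl' : l' ∈ dualWeightLattice b.flip) :
    gridInner b ξ j M (fun x => eFun b l x) (fun x => eFun b l' x)
      = ∑ w' : evenWeylGroup b, ∑ w : evenWeylGroup b,
        if ∃ q ∈ rootLattice b, (w : V ≃ₗ[ℝ] V) l - (w' : V ≃ₗ[ℝ] V) l' = (M : ℝ) • q then
          (Nat.card (torusGrid b M) : ℂ) else 0 := by
  have := hP.finite_torusGrid b hM
  have := Fintype.ofFinite (torusGrid b M)
  have h1 := hP.sum_torusGrid b j hM hξ (h := fun x => eFun b l x * (starRingEnd ℂ) (eFun b l' x))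
    (fun x _ q hq => by simp only [hP.eFun_add_right b hl _ hq, hP.eFun_add_right b hl' _ hq])
    (fun x w hw => by simp only [hP.eFun_apply_right b _ _ hw])
  simp only [gridInner, mul_assoc]
  rw [← h1]
  simp only [eFun_eq, map_sum, conj_expI, Finset.sum_mul_sum, ← expI_add, ← inner_neg_left,
    ← inner_add_left]
  rw [Finset.sum_comm, Finset.sum_congr rfl fun _ _ => Finset.sum_comm, Finset.sum_comm]
  refine Finset.sum_congr rfl fun w' _ => Finset.sum_congr rfl fun w _ => ?_
  rw [Nat.card_eq_fintype_card, ← sub_eq_add_neg]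
  exact hP.sum_expI b hM (sub_mem_dualWeightLattice b.flip
    (hP.flip.apply_mem_dualWeightLattice b.flip (by rw [hP.weylGroup_flip b]; exact w.2.1) hl)
    (hP.flip.apply_mem_dualWeightLattice b.flip (by rw [hP.weylGroup_flip b]; exact w'.2.1) hl'))

/-- A nonzero term would put l and l' in one W^e-orbit modulo MQ. -/
theorem IsEuclidean.gridInner_eFun_of_ne {l l' : V} (hl : l ∈ weightGrid b η j' M)
    (hl' : l' ∈ weightGrid b η j' M) (hne : l ≠ l') :
    gridInner b ξ j M (fun x => eFun b l x) (fun x => eFun b l' x) = 0 := by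
  rw [hP.gridInner_eFun b hξ j hM hl.1 hl'.1]
  refine Finset.sum_eq_zero fun w' _ => Finset.sum_eq_zero fun w _ => if_neg ?_
  rintro ⟨q, hq, h⟩
  refine hne (hP.eq_of_mem_weightGrid b hη j' hM hl' hl
    (mul_mem (inv_mem w.2) w'.2) (weylGroup_apply_mem_rootLattice b (inv_mem w.2.1) hq) ?_)
  have hinv : (w : V ≃ₗ[ℝ] V)⁻¹ ((w : V ≃ₗ[ℝ] V) l) = l := (w : V ≃ₗ[ℝ] V).symm_apply_apply l
  rw [← map_smul, ← h, map_sub, hinv, LinearEquiv.mul_apply]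
  abel

omit hη in
theorem IsEuclidean.gridInner_eFun_self {l : V} (hl : l ∈ dualWeightLattice b.flip) :
    gridInner b ξ j M (fun x => eFun b l x) (fun x => eFun b l x)
      = (centerOrder b : ℂ) * (Nat.card (evenWeylGroup b) : ℂ) * (M : ℂ) ^ b.support.card
        * (stabOrder b M l : ℂ) := by
  classical
  rw [hP.gridInner_eFun b hξ j hM hl hl]
  have h1 : ∀ w' : evenWeylGroup b, (∑ w : evenWeylGroup b,
      if ∃ q ∈ rootLattice b, (w : V ≃ₗ[ℝ] V) l - (w' : V ≃ₗ[ℝ] V) l = (M : ℝ) • q then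
          (Nat.card (torusGrid b M) : ℂ) else 0)
      = stabOrder b M l * (Nat.card (torusGrid b M) : ℂ) := by
    intro w'
    have hs : stabOrder b M l = (Finset.univ.filter fun w : evenWeylGroup b =>
        ∃ q ∈ rootLattice b, (w : V ≃ₗ[ℝ] V) l = l + (M : ℝ) • q).card := by
      rw [stabOrder, Nat.card_eq_fintype_card, Fintype.card_subtype]
    -- Replacing w by w'w turns the condition into: w stabilizes l + MQ.
    rw [← Equiv.sum_comp (Equiv.mulLeft w'), ← Finset.sum_filter, Finset.sum_const, nsmul_eq_mul,
      hs]
    congr 3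
    ext w
    simp only [Finset.mem_filter, Finset.mem_univ, true_and, Equiv.coe_mulLeft, Subgroup.coe_mul,
      LinearEquiv.mul_apply, ← map_sub]
    constructor
    · rintro ⟨q, hq, h⟩
      refine ⟨_, weylGroup_apply_mem_rootLattice b (inv_mem w'.2.1) hq, ?_⟩
      rw [← map_smul, ← h, ← sub_eq_iff_eq_add']
      exact ((w' : V ≃ₗ[ℝ] V).symm_apply_apply _).symm
    · rintro ⟨q, hq, h⟩
      refine ⟨_, weylGroup_apply_mem_rootLattice b w'.2.1 hq, ?_⟩
      rw [← map_smul, h, add_sub_cancel_left]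
  have h2 : (Nat.card (torusGrid b M) : ℂ) = (centerOrder b : ℂ) * (M : ℂ) ^ b.support.card := by
    exact_mod_cast congrArg (Int.cast : ℤ → ℂ) (hP.card_torusGrid b hM)
  rw [Finset.sum_congr rfl fun w' _ => h1 w', Finset.sum_const, nsmul_eq_mul, Finset.card_univ,
    ← Nat.card_eq_fintype_card, h2]
  ring

omit [P.IsReduced] hP hξ hη [P.IsCrystallographic] [P.IsRootSystem] hM in
theorem stabOrder_pos [P.IsRootSystem] (l : V) : 0 < stabOrder b M l := by
  have : Nonempty {w : evenWeylGroup b // ∃ q ∈ rootLattice b,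
      (w : V ≃ₗ[ℝ] V) l = l + (M : ℝ) • q} := ⟨⟨1, 0, zero_mem _, by simp⟩⟩
  exact Nat.card_pos

/-- Every function on the grid is interpolated by a combination of `E`-functions. -/
theorem IsEuclidean.exists_interpolant (f : pointGrid b ξ j M → ℂ) :
    ∃ c : weightGrid b η j' M → ℂ, ∀ x : pointGrid b ξ j M, interpolant b η j' M c x = f x := by
  classical
  have := hP.finite_torusGrid b hM
  have := (hP.finite_weightGrid b hη j' hM).fintype
  obtain ⟨r, -, hr⟩ := hP.exists_retraction b j hξ
  -- The W^e-invariant extension of f. By `hF` the default 0 is not taken at the points w x.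
  let F : torusGrid b M → ℂ := fun a =>
    if h : r (a : V ⧸ rootLattice b.flip).out ∈ pointGrid b ξ j M then f ⟨_, h⟩ else 0
  have hmem : ∀ (x : pointGrid b ξ j M) (w : evenWeylGroup b),
      (w : V ≃ₗ[ℝ] V) x ∈ refinedLattice b M := fun x w =>
    hP.apply_mem_refinedLattice b w.2.1 (mem_refinedLattice b |>.2 x.2.1)
  have hF : ∀ (x : pointGrid b ξ j M) (w : evenWeylGroup b),
      F ⟨QuotientAddGroup.mk' _ _, AddSubgroup.mem_map_of_mem _ (hmem x w)⟩ = f x := by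
    intro x w
    obtain ⟨q, hq, h⟩ := exists_out_mk b ((w : V ≃ₗ[ℝ] V) x)
    have h1 : r (QuotientAddGroup.mk ((w : V ≃ₗ[ℝ] V) x) : V ⧸ rootLattice b.flip).out = x := by
      rw [h, hr w w.2 q hq x x.2.2]
    have h2 := h1 ▸ x.2
    exact (dif_pos h2).trans (congrArg f (Subtype.ext h1))
  choose lam hlam hlam' using fun ψ => hP.exists_weight_of_addChar b hM (M := M) ψ
  choose lam' hlam'' w₀ hw₀ q₀ hq₀ hlam0 using fun ψ =>
    hP.exists_mem_weightGrid b hη j' hM (hlam ψ)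
  have hE : ∀ (x : pointGrid b ξ j M) ψ, eFun b (lam' ψ) (x : V) = ∑ w : evenWeylGroup b,
      ψ ⟨QuotientAddGroup.mk' _ _, AddSubgroup.mem_map_of_mem _ (hmem x w)⟩ := by
    intro x ψ
    rw [hlam0, eFun_add_left b _ (mem_refinedLattice b |>.2 x.2.1) (hq₀ ψ),
      eFun_apply_left b _ _ (hw₀ ψ), hP.eFun_eq']
    exact Finset.sum_congr rfl fun w _ => (hlam' ψ _ (hmem x w)).symm
  set C := (AddChar.complexBasis (torusGrid b M)).repr F with hC
  have hCF : ∀ a, ∑ ψ, C ψ * ψ a = F a := by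
    intro a
    conv_rhs => rw [← (AddChar.complexBasis (torusGrid b M)).sum_repr F]
    simp [hC]
  have hcard : (Nat.card (evenWeylGroup b) : ℂ) ≠ 0 := by exact_mod_cast Nat.card_pos.ne'
  -- Each character's coefficient goes to the representative of its weight's orbit. The factor
  -- 1/|W^e| compensates for summing the expansion of F over the points w x, where F always equals f
  -- x.
  refine ⟨fun l => ∑ ψ with (⟨lam' ψ, hlam'' ψ⟩ : weightGrid b η j' M) = l,
    (Nat.card (evenWeylGroup b) : ℂ)⁻¹ * C ψ, fun x => ?_⟩
  rw [interpolant, finsum_eq_sum_of_fintype]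
  have h1 : ∀ l : weightGrid b η j' M,
      (∑ ψ with (⟨lam' ψ, hlam'' ψ⟩ : weightGrid b η j' M) = l,
        (Nat.card (evenWeylGroup b) : ℂ)⁻¹ * C ψ) * eFun b (l : V) x
      = ∑ ψ with (⟨lam' ψ, hlam'' ψ⟩ : weightGrid b η j' M) = l,
        (Nat.card (evenWeylGroup b) : ℂ)⁻¹ * (C ψ * eFun b (lam' ψ) x) := by
    intro l
    rw [Finset.sum_mul]
    refine Finset.sum_congr rfl fun ψ hψ => ?_
    rw [← (Finset.mem_filter.1 hψ).2, mul_assoc]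
  rw [Finset.sum_congr rfl fun l _ => h1 l, Finset.sum_fiberwise, ← Finset.mul_sum,
    inv_mul_eq_iff_eq_mul₀ hcard]
  simp only [hE, Finset.mul_sum]
  rw [Finset.sum_comm]
  simp only [hCF, hF, Finset.sum_const, nsmul_eq_mul, Finset.card_univ, Nat.card_eq_fintype_card]

end Orthogonality

/-! ### Coefficients and Plancherel identity -/

section Interpolation

variable {V : Type*} [NormedAddCommGroup V] [InnerProductSpace ℝ V] {ι : Type*} [Finite ι]
  {P : RootPairing ι ℝ V V} (b : P.Base) [P.IsRootSystem] [P.IsCrystallographic]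
  [P.IsReduced] (hP : IsEuclidean P) {ξ η : ι} (hξ : IsHighestRoot b ξ)
  (hη : IsHighestRoot b.flip η) (j : b.support) (j' : b.flip.support) {M : ℕ} (hM : 0 < M)

omit [Finite ι] [P.IsRootSystem] [P.IsCrystallographic] [P.IsReduced] in
theorem gridInner_conj_symm (f g : pointGrid b ξ j M → ℂ) (hfin : (pointGrid b ξ j M).Finite) :
    gridInner b ξ j M f g = (starRingEnd ℂ) (gridInner b ξ j M g f) := by
  have := hfin.fintype
  rw [gridInner, gridInner, finsum_eq_sum_of_fintype, finsum_eq_sum_of_fintype, map_sum]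
  refine Finset.sum_congr rfl fun x _ => ?_
  simp only [map_mul, Complex.conj_conj, map_natCast]
  ring

omit [P.IsCrystallographic] [P.IsReduced] in
theorem gridInner_interpolant (hfin : (pointGrid b ξ j M).Finite)
    [Fintype (weightGrid b η j' M)] (c : weightGrid b η j' M → ℂ) (g : pointGrid b ξ j M → ℂ) :
    gridInner b ξ j M (fun x => interpolant b η j' M c x) g
      = ∑ l, c l * gridInner b ξ j M (fun x => eFun b (l : V) x) g := by
  have := hfin.fintype
  simp only [gridInner, interpolant, finsum_eq_sum_of_fintype, Finset.mul_sum, Finset.sum_mul]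
  rw [Finset.sum_comm]
  refine Finset.sum_congr rfl fun l _ => Finset.sum_congr rfl fun x _ => ?_
  ring

include hP hξ hη hM

omit hη in
theorem IsEuclidean.gridInner_eFun_self_ne_zero {l : V} (hl : l ∈ dualWeightLattice b.flip) :
    gridInner b ξ j M (fun x => eFun b l x) (fun x => eFun b l x) ≠ 0 := by
  rw [hP.gridInner_eFun_self b hξ j hM hl]
  have h1 := (hP.centerOrder_pos b).ne'
  have h2 : Nat.card (evenWeylGroup b) ≠ 0 := Nat.card_pos.ne'
  have h3 := (stabOrder_pos b (M := M) l).ne'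
  have h4 := hM.ne'
  simp [h1, h3, h4]

theorem IsEuclidean.gridInner_interpolant_eFun (c : weightGrid b η j' M → ℂ)
    (l : weightGrid b η j' M) :
    gridInner b ξ j M (fun x => interpolant b η j' M c x) (fun x => eFun b (l : V) x)
      = c l * gridInner b ξ j M (fun x => eFun b (l : V) x) (fun x => eFun b (l : V) x) := by
  have := (hP.finite_weightGrid b hη j' hM).fintype
  rw [gridInner_interpolant b j j' (hP.finite_pointGrid b j hM hξ)]
  refine Finset.sum_eq_single l (fun l' _ hne => ?_) fun h => absurd (Finset.mem_univ l) h
  rw [hP.gridInner_eFun_of_ne b hξ hη j j' hM l'.2 l.2 fun h => hne (Subtype.ext h), mul_zero]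

theorem IsEuclidean.gridInner_interpolant_self (c : weightGrid b η j' M → ℂ) :
    gridInner b ξ j M (fun x => interpolant b η j' M c x) (fun x => interpolant b η j' M c x)
      = (centerOrder b : ℂ) * (Nat.card (evenWeylGroup b) : ℂ) * (M : ℂ) ^ b.support.card *
        ∑ᶠ l : weightGrid b η j' M, (stabOrder b M (l : V) : ℂ) * (‖c l‖ : ℂ) ^ 2 := by
  have := (hP.finite_weightGrid b hη j' hM).fintype
  have hfin := hP.finite_pointGrid b j hM hξ
  rw [gridInner_interpolant b j j' hfin, finsum_eq_sum_of_fintype, Finset.mul_sum]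
  refine Finset.sum_congr rfl fun l _ => ?_
  rw [gridInner_conj_symm b j _ _ hfin, hP.gridInner_interpolant_eFun b hξ hη j j' hM, map_mul,
    ← gridInner_conj_symm b j _ _ hfin, hP.gridInner_eFun_self b hξ j hM l.2.1, ← mul_assoc,
    Complex.mul_conj']
  ring

end Interpolation

end ETransform

end

/-! ### The interpolation theorem -/

theorem mainTheorem6 {n : ℕ} {ι : Type*} [Finite ι]
    (P : RootPairing ι ℝ (EuclideanSpace ℝ (Fin n)) (EuclideanSpace ℝ (Fin n)))
    [P.IsRootSystem] [P.IsCrystallographic] [P.IsReduced] [P.IsIrreducible]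
    (hP : ETransform.IsEuclidean P) (b : P.Base)
    (ξ η : ι) (hξ : ETransform.IsHighestRoot b ξ) (hη : ETransform.IsHighestRoot b.flip η)
    (j : b.support) (j' : b.flip.support) (M : ℕ) (hM : 0 < M)
    (f : ETransform.pointGrid b ξ j M → ℂ) :
    (ETransform.pointGrid b ξ j M).Finite ∧
    (ETransform.weightGrid b η j' M).Finite ∧
    (∃! c : ETransform.weightGrid b η j' M → ℂ,
      ∀ x : ETransform.pointGrid b ξ j M, ETransform.interpolant b η j' M c x = f x) ∧
    ∀ c : ETransform.weightGrid b η j' M → ℂ,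
      (∀ x : ETransform.pointGrid b ξ j M, ETransform.interpolant b η j' M c x = f x) →
      (∀ l : ETransform.weightGrid b η j' M,
        ETransform.gridInner b ξ j M (fun x => ETransform.eFun b l x)
            (fun x => ETransform.eFun b l x) ≠ 0 ∧
        c l = ETransform.gridInner b ξ j M f (fun x => ETransform.eFun b l x) /
            ETransform.gridInner b ξ j M (fun x => ETransform.eFun b l x)
              (fun x => ETransform.eFun b l x) ∧
        c l = ((ETransform.centerOrder b : ℂ) * (Nat.card (ETransform.evenWeylGroup b) : ℂ) *
              (M : ℂ) ^ n * (ETransform.stabOrder b M l : ℂ))⁻¹ *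
            ∑ᶠ x : ETransform.pointGrid b ξ j M,
              (ETransform.orbitSize b (x : EuclideanSpace ℝ (Fin n)) : ℂ) * f x * (starRingEnd ℂ) (ETransform.eFun b l x)) ∧
      ∑ᶠ x : ETransform.pointGrid b ξ j M,
          (ETransform.orbitSize b (x : EuclideanSpace ℝ (Fin n)) : ℝ) * ‖f x‖ ^ 2 =
        (ETransform.centerOrder b : ℝ) * (Nat.card (ETransform.evenWeylGroup b) : ℝ) * (M : ℝ) ^ n *
          ∑ᶠ l : ETransform.weightGrid b η j' M,
            (ETransform.stabOrder b M (l : EuclideanSpace ℝ (Fin n)) : ℝ) * ‖c l‖ ^ 2 := by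
  have hn : b.support.card = n := by
    rw [← Fintype.card_coe, ← Module.finrank_eq_card_basis b.toWeightBasis, finrank_euclideanSpace,
      Fintype.card_fin]
  have hfin := hP.finite_pointGrid b j hM hξ
  have hfin' := hP.finite_weightGrid b hη j' hM
  -- Orthogonality isolates each coefficient; uniqueness and both formulas for it follow, since the
  -- norms are nonzero.
  have hcoeff : ∀ c : ETransform.weightGrid b η j' M → ℂ,
      (∀ x : ETransform.pointGrid b ξ j M, ETransform.interpolant b η j' M c x = f x) →
      ∀ l : ETransform.weightGrid b η j' M,
        ETransform.gridInner b ξ j M f (fun x => ETransform.eFun b l x)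
          = c l * ETransform.gridInner b ξ j M (fun x => ETransform.eFun b l x)
            (fun x => ETransform.eFun b l x) := by
    intro c hc l
    rw [← hP.gridInner_interpolant_eFun b hξ hη j j' hM, funext hc]
  have hne := fun l : ETransform.weightGrid b η j' M =>
    hP.gridInner_eFun_self_ne_zero b hξ j hM l.2.1
  refine ⟨hfin, hfin', ?_, fun c hc => ⟨fun l => ⟨hne l, ?_, ?_⟩, ?_⟩⟩
  · obtain ⟨c, hc⟩ := hP.exists_interpolant b hξ hη j j' hM f
    refine ⟨c, hc, fun c' hc' => funext fun l => mul_right_cancel₀ (hne l) ?_⟩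
    rw [← hcoeff c hc, ← hcoeff c' hc']
  · rw [hcoeff c hc, mul_div_cancel_right₀ _ (hne l)]
  · have hN := hP.gridInner_eFun_self b hξ j hM l.2.1
    rw [hn] at hN
    rw [← hN, eq_inv_mul_iff_mul_eq₀ (hne l), mul_comm,
      ← hcoeff c hc]
    rfl
  · have h := hP.gridInner_interpolant_self b hξ hη j j' hM c
    have := hfin.fintype
    have := hfin'.fintype
    rw [funext hc, hn] at h
    rw [ETransform.gridInner, finsum_eq_sum_of_fintype, finsum_eq_sum_of_fintype] at h
    simp only [mul_assoc, Complex.mul_conj'] at h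
    rw [finsum_eq_sum_of_fintype, finsum_eq_sum_of_fintype]
    simp only [mul_assoc]
    exact_mod_cast h
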